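/- **Definitions.** A *curve* is a differentiable function $f:[a,b]\to\mathbb C$ ($a<b$) whose derivative $f'$ is absolutely continuous and nowhere zero. Its length is $L=\int_a^b|f'(t)|\,dt$, and the unit speed curve described by $f$ is $[f]=F:[0,L]\to\mathbb C$, $F(s)=f(t)$ where $s=\int_a^t|f'(r)|\,dr$. Two curves $f,g$ are *equivalent* if $[f]=[g]$. There is an absolutely continuous $\tau:[0,L]\to\mathbb R$, unique up to an additive constant in $2\pi\mathbb Z$, with $F'=e^{i\tau}$; the *signed curvature* is $\kappa=\tau'$ (defined almost everywhere), the *turning angle* is $\int_0^L\kappa\,ds$, and the *bending energy* of $f$ is $\|f\|^2=\frac14\int_0^L\kappa(s)^2\,ds\in[0,\infty]$. The curve $f$ is a *left-curve* (resp. *right-curve*) if $\kappa\ge0$ (resp. $\kappa\le 0$) almost everywhere, and a *c-curve* is a left-curve or a right-curve whose turning angle has magnitude at most $\pi$. An *s-curve* is a curve that is either a c-curve or, up to equivalence, the concatenation $f_1\sqcup f_2$ of two c-curves, one a left-curve and the other a right-curve (in either order), where the terminal unit tangent vector of $f_1$ equals the initial unit tangent vector of $f_2$. The *unit tangent vector*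 of $f$ at $t$ is the pair $(f(t),f'(t)/|f'(t)|)$; $f$ *connects* $u$ to $v$ if its unit tangent vectors at $a$ and $b$ are $u$ and $v$, and $S(u,v)$ denotes the set of all s-curves connecting $u$ to $v$. Let $E(t)=\sin t+i\,\xi(t)$, $t\in\mathbb R$, where $\xi(t)=\int_0^t\frac{\sin^2 r}{\sqrt{1+\sin^2 r}}\,dr$; let $TE(t)=(E(t),E'(t)/|E'(t)|)$, and let $E_{[t_1,t_2]}$ be the restriction of $E$ to $[t_1,t_2]$. **Theorem 6.1.** Let $0\le t_1<t_2\le\pi$ with $t_2-t_1<\pi$. Then $E_{[t_1,t_2]}$ belongs to $S(TE(t_1),TE(t_2))$ and has minimal bending energy in $S(TE(t_1),TE(t_2))$, and every curve in $S(TE(t_1),TE(t_2))$ of minimal bending energy is equivalent to $E_{[t_1,t_2]}$. -/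

import Mathlib

open Set MeasureTheory Filter Topology
open scoped ENNReal NNReal

/-! ### Plane curves -/

/-- A curve: a differentiable function `[a, b] → ℂ` (`a < b`) whose derivative is absolutely
continuous and nowhere zero. Differentiability is on the closed interval (one-sided at the
endpoints); the values of `toFun` outside `[a, b]` are irrelevant. -/
structure PlaneCurve where
  /-- left endpoint of the parameter interval -/
  a : ℝ
  /-- right endpoint of the parameter interval -/
  b : ℝ
  lt : a < b
  /-- the map itself -/
  toFun : ℝ → ℂ
  differentiableOn : DifferentiableOn ℝ toFun (Icc a b)
  absCont : AbsolutelyContinuousOnInterval (derivWithin toFun (Icc a b)) a b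
  ne_zero : ∀ t ∈ Icc a b, derivWithin toFun (Icc a b) t ≠ 0

/-- A unit tangent vector: a base point together with a direction of modulus one. -/
@[ext]
structure UnitTangentVector where
  /-- the base point -/
  pos : ℂ
  /-- the direction -/
  dir : ℂ
  norm_dir : ‖dir‖ = 1

theorem absCont_of_locally_dist_le {X Y : Type*} [PseudoMetricSpace X] [PseudoMetricSpace Y]
    {g : ℝ → X} {h : ℝ → Y} {a b δ₀ K : ℝ} (hδ₀ : 0 < δ₀) (hK : 0 ≤ K)
    (hg : AbsolutelyContinuousOnInterval g a b)
    (hgh : ∀ x ∈ uIcc a b, ∀ y ∈ uIcc a b, dist x y < δ₀ → dist (h x) (h y) ≤ K * dist (g x) (g y)) :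
    AbsolutelyContinuousOnInterval h a b := by
  rw [absolutelyContinuousOnInterval_iff] at hg ⊢
  intro ε hε
  obtain ⟨δ, hδ, H⟩ := hg (ε / (K + 1)) (by positivity)
  refine ⟨min δ δ₀, lt_min hδ hδ₀, fun E hE hlt => ?_⟩
  have h1 := H E hE (hlt.trans_le (min_le_left _ _))
  calc ∑ i ∈ Finset.range E.1, dist (h (E.2 i).1) (h (E.2 i).2)
      ≤ ∑ i ∈ Finset.range E.1, K * dist (g (E.2 i).1) (g (E.2 i).2) := by
        refine Finset.sum_le_sum fun i hi => hgh _ (hE.1 i hi).1 _ (hE.1 i hi).2 ?_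
        refine lt_of_le_of_lt ?_ (hlt.trans_le (min_le_right _ _))
        exact Finset.single_le_sum (f := fun i => dist (E.2 i).1 (E.2 i).2)
          (fun _ _ => dist_nonneg) hi
    _ = K * ∑ i ∈ Finset.range E.1, dist (g (E.2 i).1) (g (E.2 i).2) := by rw [Finset.mul_sum]
    _ ≤ K * (ε / (K + 1)) := by gcongr
    _ < (K + 1) * (ε / (K + 1)) := by gcongr; linarith
    _ = ε := by field_simp

theorem absCont_comp_of_monotoneOn {X : Type*} [PseudoMetricSpace X] {g : ℝ → X} {φ : ℝ → ℝ}
    {a b c d : ℝ} {K : ℝ≥0} (hab : a ≤ b) (hcd : c ≤ d)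
    (hg : AbsolutelyContinuousOnInterval g a b) (hmono : MonotoneOn φ (Icc c d))
    (hmaps : MapsTo φ (Icc c d) (Icc a b)) (hlip : LipschitzOnWith K φ (Icc c d)) :
    AbsolutelyContinuousOnInterval (fun s => g (φ s)) c d := by
  rw [absolutelyContinuousOnInterval_iff] at hg ⊢
  intro ε hε
  obtain ⟨δ, hδ, H⟩ := hg ε hε
  refine ⟨δ / (K + 1), by positivity, fun E hE hlt => ?_⟩
  obtain ⟨hE1, hE2⟩ := hE
  rw [uIcc_of_le hcd] at hE1
  have hmin : ∀ x ∈ Icc c d, ∀ y ∈ Icc c d, φ (min x y) = min (φ x) (φ y) := by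
    intro x hx y hy
    rcases le_total x y with h | h
    · rw [min_eq_left h, min_eq_left (hmono hx hy h)]
    · rw [min_eq_right h, min_eq_right (hmono hy hx h)]
  have hmax : ∀ x ∈ Icc c d, ∀ y ∈ Icc c d, φ (max x y) = max (φ x) (φ y) := by
    intro x hx y hy
    rcases le_total x y with h | h
    · rw [max_eq_right h, max_eq_right (hmono hx hy h)]
    · rw [max_eq_left h, max_eq_left (hmono hy hx h)]
  have hcmin : ∀ x ∈ Icc c d, ∀ y ∈ Icc c d, min x y ∈ Icc c d := by
    intro x hx y hy
    exact ⟨le_min hx.1 hy.1, (min_le_left _ _).trans hx.2⟩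
  have hcmax : ∀ x ∈ Icc c d, ∀ y ∈ Icc c d, max x y ∈ Icc c d := by
    intro x hx y hy
    exact ⟨hx.1.trans (le_max_left _ _), max_le hx.2 hy.2⟩
  refine H (E.1, fun i => (φ (E.2 i).1, φ (E.2 i).2)) ⟨?_, ?_⟩ ?_
  · intro i hi
    rw [uIcc_of_le hab]
    exact ⟨hmaps (hE1 i hi).1, hmaps (hE1 i hi).2⟩
  · intro i hi j hj hij
    have h1 := hE2 hi hj hij
    obtain ⟨hi1, hi2⟩ := hE1 i (by simpa using hi)
    obtain ⟨hj1, hj2⟩ := hE1 j (by simpa using hj)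
    simp only [Function.onFun, uIoc, Ioc_disjoint_Ioc] at h1 ⊢
    rw [← hmin _ hi1 _ hi2, ← hmin _ hj1 _ hj2, ← hmax _ hi1 _ hi2, ← hmax _ hj1 _ hj2,
      ← hmin _ (hcmax _ hi1 _ hi2) _ (hcmax _ hj1 _ hj2),
      ← hmax _ (hcmin _ hi1 _ hi2) _ (hcmin _ hj1 _ hj2)]
    exact hmono (hcmin _ (hcmax _ hi1 _ hi2) _ (hcmax _ hj1 _ hj2))
      (hcmax _ (hcmin _ hi1 _ hi2) _ (hcmin _ hj1 _ hj2)) h1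
  · calc ∑ i ∈ Finset.range E.1, dist (φ (E.2 i).1) (φ (E.2 i).2)
        ≤ ∑ i ∈ Finset.range E.1, K * dist (E.2 i).1 (E.2 i).2 :=
          Finset.sum_le_sum fun i hi => hlip.dist_le_mul _ (hE1 i hi).1 _ (hE1 i hi).2
      _ = K * ∑ i ∈ Finset.range E.1, dist (E.2 i).1 (E.2 i).2 := by rw [Finset.mul_sum]
      _ ≤ K * (δ / (K + 1)) := by gcongr
      _ < (K + 1) * (δ / (K + 1)) := by gcongr; linarith
      _ = δ := by field_simp

theorem dist_normalize_le {z w : ℂ} {m : ℝ} (hm : 0 < m) (hz : m ≤ ‖z‖) (hw : w ≠ 0) :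
    dist (z / (‖z‖ : ℂ)) (w / (‖w‖ : ℂ)) ≤ 2 / m * dist z w := by
  have hz0 : 0 < ‖z‖ := hm.trans_le hz
  have hw0 : 0 < ‖w‖ := norm_pos_iff.mpr hw
  have e : z / (‖z‖ : ℂ) - w / (‖w‖ : ℂ)
      = (z - w) / (‖z‖ : ℂ) + (w / (‖w‖ : ℂ)) * (((‖w‖ - ‖z‖ : ℝ) : ℂ) / (‖z‖ : ℂ)) := by
    have h1 : (‖z‖ : ℂ) ≠ 0 := by exact_mod_cast hz0.ne'
    have h2 : (‖w‖ : ℂ) ≠ 0 := by exact_mod_cast hw0.ne'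
    push_cast
    field_simp
    ring
  rw [dist_eq_norm, dist_eq_norm, e]
  refine (norm_add_le _ _).trans ?_
  rw [norm_mul, norm_div, norm_div, norm_div, Complex.norm_real, Complex.norm_real,
    Complex.norm_real, norm_norm, norm_norm, div_self hw0.ne', one_mul]
  have h3 : ‖(‖w‖ - ‖z‖ : ℝ)‖ ≤ ‖z - w‖ := by
    rw [norm_sub_rev z w]; exact abs_norm_sub_norm_le w z
  calc ‖z - w‖ / ‖z‖ + ‖(‖w‖ - ‖z‖ : ℝ)‖ / ‖z‖ ≤ ‖z - w‖ / m + ‖z - w‖ / m := by gcongr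
    _ = 2 / m * ‖z - w‖ := by ring

namespace PlaneCurve

/-- The derivative `f'` on `[a, b]`. -/
noncomputable def vel (f : PlaneCurve) (t : ℝ) : ℂ := derivWithin f.toFun (Icc f.a f.b) t

/-- The unit tangent vector `(f(t), f'(t)/|f'(t)|)` to `f` at `t ∈ [a, b]`. -/
noncomputable def tangent (f : PlaneCurve) (t : ℝ) (ht : t ∈ Icc f.a f.b) : UnitTangentVector where
  pos := f.toFun t
  dir := f.vel t / (‖f.vel t‖ : ℂ)
  norm_dir := by
    have h : ‖f.vel t‖ ≠ 0 := norm_ne_zero_iff.mpr (f.ne_zero t ht)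
    rw [norm_div, Complex.norm_real, norm_norm, div_self h]

/-- The initial unit tangent vector. -/
noncomputable def initial (f : PlaneCurve) : UnitTangentVector :=
  f.tangent f.a (left_mem_Icc.mpr f.lt.le)

/-- The terminal unit tangent vector. -/
noncomputable def terminal (f : PlaneCurve) : UnitTangentVector :=
  f.tangent f.b (right_mem_Icc.mpr f.lt.le)

/-- `f` connects `u` to `v`. -/
def Connects (f : PlaneCurve) (u v : UnitTangentVector) : Prop :=
  f.initial = u ∧ f.terminal = v

/-- Arc length from the initial point, `s(t) = ∫_a^t |f'|`. -/
noncomputable def arcLength (f : PlaneCurve) (t : ℝ) : ℝ := ∫ r in f.a..t, ‖f.vel r‖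

/-- The length of the curve. -/
noncomputable def length (f : PlaneCurve) : ℝ := f.arcLength f.b

/-- The inverse `[0, L] → [a, b]` of the arc length function. -/
noncomputable def arcParam (f : PlaneCurve) (s : ℝ) : ℝ :=
  Function.invFunOn f.arcLength (Icc f.a f.b) s

theorem continuousOn_vel (f : PlaneCurve) : ContinuousOn f.vel (Icc f.a f.b) := by
  have h := f.absCont.continuousOn
  rwa [uIcc_of_le f.lt.le] at h

theorem exists_speed_lower_bound (f : PlaneCurve) :
    ∃ m : ℝ, 0 < m ∧ ∀ t ∈ Icc f.a f.b, m ≤ ‖f.vel t‖ := by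
  obtain ⟨x, hx, hmin⟩ := isCompact_Icc.exists_isMinOn (nonempty_Icc.mpr f.lt.le)
    f.continuousOn_vel.norm
  exact ⟨‖f.vel x‖, norm_pos_iff.mpr (f.ne_zero x hx), fun t ht => hmin ht⟩

theorem intervalIntegrable_speed (f : PlaneCurve) {x y : ℝ} (hx : x ∈ Icc f.a f.b)
    (hy : y ∈ Icc f.a f.b) : IntervalIntegrable (fun r => ‖f.vel r‖) volume x y := by
  refine ContinuousOn.intervalIntegrable (f.continuousOn_vel.norm.mono ?_)
  exact uIcc_subset_Icc hx hy

theorem mul_sub_le_arcLength_sub (f : PlaneCurve) {m : ℝ}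
    (hm : ∀ t ∈ Icc f.a f.b, m ≤ ‖f.vel t‖) {x y : ℝ} (hx : x ∈ Icc f.a f.b)
    (hy : y ∈ Icc f.a f.b) (hxy : x ≤ y) : m * (y - x) ≤ f.arcLength y - f.arcLength x := by
  have ha : f.a ∈ Icc f.a f.b := left_mem_Icc.mpr f.lt.le
  unfold arcLength
  rw [intervalIntegral.integral_interval_sub_left (f.intervalIntegrable_speed ha hy)
    (f.intervalIntegrable_speed ha hx)]
  have h := intervalIntegral.integral_mono_on hxy intervalIntegrable_const
    (f.intervalIntegrable_speed hx hy)
    (fun t ht => hm t ⟨hx.1.trans ht.1, ht.2.trans hy.2⟩)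
  rw [intervalIntegral.integral_const, smul_eq_mul] at h
  linarith

theorem hasDerivWithinAt_arcLength (f : PlaneCurve) {t : ℝ} (ht : t ∈ Icc f.a f.b) :
    HasDerivWithinAt f.arcLength ‖f.vel t‖ (Icc f.a f.b) t := by
  have ha : f.a ∈ Icc f.a f.b := left_mem_Icc.mpr f.lt.le
  have : Fact (t ∈ Icc f.a f.b) := ⟨ht⟩
  refine intervalIntegral.integral_hasDerivWithinAt_right (f.intervalIntegrable_speed ha ht)
    (t := Icc f.a f.b) ?_ (f.continuousOn_vel.norm t ht)
  exact ContinuousOn.stronglyMeasurableAtFilter_nhdsWithin f.continuousOn_vel.norm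
    measurableSet_Icc t

theorem arcLength_left (f : PlaneCurve) : f.arcLength f.a = 0 := by
  simp [arcLength]

theorem strictMonoOn_arcLength (f : PlaneCurve) : StrictMonoOn f.arcLength (Icc f.a f.b) := by
  obtain ⟨m, hm0, hm⟩ := f.exists_speed_lower_bound
  intro x hx y hy hxy
  have h := f.mul_sub_le_arcLength_sub hm hx hy hxy.le
  have : 0 < m * (y - x) := mul_pos hm0 (sub_pos.mpr hxy)
  linarith

theorem length_pos (f : PlaneCurve) : 0 < f.length := by
  have h := f.strictMonoOn_arcLength (left_mem_Icc.mpr f.lt.le) (right_mem_Icc.mpr f.lt.le) f.lt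
  rwa [f.arcLength_left] at h

theorem image_arcLength (f : PlaneCurve) : Icc 0 f.length ⊆ f.arcLength '' Icc f.a f.b := by
  have hc : ContinuousOn f.arcLength (Icc f.a f.b) :=
    fun t ht => (f.hasDerivWithinAt_arcLength ht).continuousWithinAt
  have h := intermediate_value_Icc f.lt.le hc
  rwa [f.arcLength_left] at h

theorem arcParam_mem (f : PlaneCurve) {s : ℝ} (hs : s ∈ Icc 0 f.length) :
    f.arcParam s ∈ Icc f.a f.b := Function.invFunOn_mem (f.image_arcLength hs)

theorem arcLength_arcParam (f : PlaneCurve) {s : ℝ} (hs : s ∈ Icc 0 f.length) :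
    f.arcLength (f.arcParam s) = s := Function.invFunOn_eq (f.image_arcLength hs)

theorem monotoneOn_arcParam (f : PlaneCurve) : MonotoneOn f.arcParam (Icc 0 f.length) := by
  intro x hx y hy hxy
  by_contra hlt
  have h := f.strictMonoOn_arcLength (f.arcParam_mem hy) (f.arcParam_mem hx) (not_le.mp hlt)
  rw [f.arcLength_arcParam hx, f.arcLength_arcParam hy] at h
  linarith

theorem exists_lipschitz_arcParam (f : PlaneCurve) :
    ∃ K : ℝ≥0, LipschitzOnWith K f.arcParam (Icc 0 f.length) := by
  obtain ⟨m, hm0, hm⟩ := f.exists_speed_lower_bound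
  refine ⟨⟨m⁻¹, by positivity⟩, LipschitzOnWith.of_dist_le_mul ?_⟩
  have key : ∀ x ∈ Icc 0 f.length, ∀ y ∈ Icc 0 f.length, x ≤ y →
      dist (f.arcParam x) (f.arcParam y) ≤ m⁻¹ * dist x y := by
    intro x hx y hy hxy
    have h1 := f.monotoneOn_arcParam hx hy hxy
    have h := f.mul_sub_le_arcLength_sub hm (f.arcParam_mem hx) (f.arcParam_mem hy) h1
    rw [f.arcLength_arcParam hx, f.arcLength_arcParam hy] at h
    rw [dist_comm, dist_comm x y, Real.dist_eq, Real.dist_eq, abs_of_nonneg (sub_nonneg.mpr h1),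
      abs_of_nonneg (sub_nonneg.mpr hxy), inv_mul_eq_div, le_div_iff₀ hm0]
    linarith
  intro x hx y hy
  rcases le_total x y with hxy | hxy
  · exact key x hx y hy hxy
  · rw [dist_comm, dist_comm x y]
    exact key y hy x hx hxy

theorem hasDerivWithinAt_unitSpeed (f : PlaneCurve) {s : ℝ} (hs : s ∈ Icc 0 f.length) :
    HasDerivWithinAt (fun s => f.toFun (f.arcParam s))
      (f.vel (f.arcParam s) / (‖f.vel (f.arcParam s)‖ : ℂ)) (Icc 0 f.length) s := by
  obtain ⟨K, hK⟩ := f.exists_lipschitz_arcParam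
  have hp := f.arcParam_mem hs
  have hmaps : MapsTo f.arcParam (Icc 0 f.length) (Icc f.a f.b) := fun x hx => f.arcParam_mem hx
  have hne : ‖f.vel (f.arcParam s)‖ ≠ 0 := norm_ne_zero_iff.mpr (f.ne_zero _ hp)
  have hσ := f.hasDerivWithinAt_arcLength hp
  have hφ : HasDerivWithinAt f.arcParam (‖f.vel (f.arcParam s)‖⁻¹) (Icc 0 f.length) s := by
    have h1 : Tendsto f.arcParam (𝓝[Icc 0 f.length] s) (𝓝[Icc f.a f.b] (f.arcParam s)) :=
      (hK.continuousOn s hs).tendsto_nhdsWithin hmaps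
    have h2 : HasFDerivWithinAt f.arcLength
        (ContinuousLinearEquiv.unitsEquivAut ℝ (Units.mk0 _ hne) : ℝ →L[ℝ] ℝ)
        (Icc f.a f.b) (f.arcParam s) := by
      have h3 : ((ContinuousLinearEquiv.unitsEquivAut ℝ (Units.mk0 _ hne) : ℝ ≃L[ℝ] ℝ) : ℝ →L[ℝ] ℝ)
          = ContinuousLinearMap.toSpanSingleton ℝ ‖f.vel (f.arcParam s)‖ := by
        ext; simp
      rw [h3]
      exact hσ.hasFDerivWithinAt
    have h3 := HasFDerivWithinAt.of_local_left_inverse h1 h2 hs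
      (eventually_nhdsWithin_of_forall fun x hx => f.arcLength_arcParam hx)
    have h4 := h3.hasDerivWithinAt
    simpa using h4
  have hf : HasDerivWithinAt f.toFun (f.vel (f.arcParam s)) (Icc f.a f.b) (f.arcParam s) :=
    (f.differentiableOn _ hp).hasDerivWithinAt
  have h := hf.scomp s hφ hmaps
  rw [Complex.real_smul, Complex.ofReal_inv, inv_mul_eq_div] at h
  exact h

theorem derivWithin_unitSpeed (f : PlaneCurve) {s : ℝ} (hs : s ∈ Icc 0 f.length) :
    derivWithin (fun s => f.toFun (f.arcParam s)) (Icc 0 f.length) s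
      = f.vel (f.arcParam s) / (‖f.vel (f.arcParam s)‖ : ℂ) :=
  (f.hasDerivWithinAt_unitSpeed hs).derivWithin (uniqueDiffOn_Icc f.length_pos s hs)

theorem norm_derivWithin_unitSpeed (f : PlaneCurve) {s : ℝ} (hs : s ∈ Icc 0 f.length) :
    ‖derivWithin (fun s => f.toFun (f.arcParam s)) (Icc 0 f.length) s‖ = 1 := by
  have h : ‖f.vel (f.arcParam s)‖ ≠ 0 := norm_ne_zero_iff.mpr (f.ne_zero _ (f.arcParam_mem hs))
  rw [f.derivWithin_unitSpeed hs, norm_div, Complex.norm_real, norm_norm, div_self h]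

/-- The unit speed curve `[f] = F : [0, L] → ℂ` described by `f`, i.e. `F(s) = f(t)` where
`s = ∫_a^t |f'|`. -/
noncomputable def unitSpeed (f : PlaneCurve) : PlaneCurve where
  a := 0
  b := f.length
  lt := f.length_pos
  toFun := fun s => f.toFun (f.arcParam s)
  differentiableOn := fun s hs => (f.hasDerivWithinAt_unitSpeed hs).differentiableWithinAt
  absCont := by
    obtain ⟨m, hm0, hm⟩ := f.exists_speed_lower_bound
    obtain ⟨K, hK⟩ := f.exists_lipschitz_arcParam
    have h1 := absCont_comp_of_monotoneOn f.lt.le f.length_pos.le f.absCont f.monotoneOn_arcParam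
      (fun x hx => f.arcParam_mem hx) hK
    refine absCont_of_locally_dist_le (δ₀ := 1) (K := 2 / m) one_pos (by positivity) h1 ?_
    rw [uIcc_of_le f.length_pos.le]
    intro x hx y hy _
    rw [f.derivWithin_unitSpeed hx, f.derivWithin_unitSpeed hy]
    exact dist_normalize_le hm0 (hm _ (f.arcParam_mem hx)) (f.ne_zero _ (f.arcParam_mem hy))
  ne_zero := fun s hs h0 => by
    have h := f.norm_derivWithin_unitSpeed hs
    rw [h0, norm_zero] at h
    exact zero_ne_one h

/-- Two curves are equivalent if they describe the same unit speed curve. -/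
def Equivalent (f g : PlaneCurve) : Prop :=
  f.length = g.length ∧ EqOn f.unitSpeed.toFun g.unitSpeed.toFun (Icc 0 f.length)

/-- `τ` is a direction angle of `F = [f]`: it is absolutely continuous and `F' = exp(iτ)` on
`[0, L]`. -/
def IsDirectionAngle (f : PlaneCurve) (τ : ℝ → ℝ) : Prop :=
  AbsolutelyContinuousOnInterval τ 0 f.length ∧
    ∀ s ∈ Icc 0 f.length, f.unitSpeed.vel s = Complex.exp (τ s * Complex.I)

theorem abs_sub_le_of_lift {x y : ℝ} (h : |x - y| ≤ Real.pi) :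
    dist x y ≤ Real.pi / 2 *
      dist (Complex.exp (x * Complex.I)) (Complex.exp (y * Complex.I)) := by
  have e : Complex.exp (x * Complex.I) - Complex.exp (y * Complex.I)
      = Complex.exp (y * Complex.I) * (Complex.exp (Complex.I * ((x - y : ℝ) : ℂ)) - 1) := by
    rw [mul_sub, ← Complex.exp_add, mul_one]
    congr 2
    push_cast
    ring
  rw [dist_eq_norm (Complex.exp _), e, norm_mul, Complex.norm_exp_ofReal_mul_I, one_mul,
    Complex.norm_exp_I_mul_ofReal_sub_one, Real.dist_eq]
  have h2 : |(x - y) / 2| ≤ Real.pi / 2 := by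
    rw [abs_div, abs_two]; linarith
  have h3 := Real.mul_abs_le_abs_sin h2
  rw [abs_div, abs_two] at h3
  rw [Real.norm_eq_abs, abs_mul, abs_two]
  have hpi := Real.pi_pos
  have h4 : |x - y| = Real.pi / 2 * (2 * (2 / Real.pi * (|x - y| / 2))) := by
    field_simp
  rw [h4]
  gcongr

/-- Every curve has a direction angle. -/
theorem exists_isDirectionAngle (f : PlaneCurve) : ∃ τ : ℝ → ℝ, f.IsDirectionAngle τ := by
  have hL := f.length_pos
  have hnorm : ∀ s ∈ Icc 0 f.length, ‖f.unitSpeed.vel s‖ = 1 :=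
    fun s hs => f.norm_derivWithin_unitSpeed hs
  have hcont : ContinuousOn f.unitSpeed.vel (Icc 0 f.length) := f.unitSpeed.continuousOn_vel
  have hcont' : Continuous fun s : ℝ => f.unitSpeed.vel (projIcc 0 f.length hL.le s) :=
    hcont.domRestrict.comp continuous_projIcc
  have hmem : ∀ s : ℝ,
      f.unitSpeed.vel (projIcc 0 f.length hL.le s) ∈ Submonoid.unitSphere ℂ := fun s =>
    mem_sphere_zero_iff_norm.mpr (hnorm _ (projIcc 0 f.length hL.le s).2)
  let γ : C(ℝ, Circle) := ⟨fun s => ⟨_, hmem s⟩, hcont'.subtype_mk hmem⟩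
  obtain ⟨e₀, he₀⟩ : ∃ e₀ : ℝ, Circle.exp e₀ = γ 0 :=
    ⟨Complex.arg (γ 0), Circle.exp_arg _⟩
  obtain ⟨Γ, ⟨-, hΓ⟩, -⟩ := Circle.isCoveringMap_exp.existsUnique_continuousMap_lifts γ 0 e₀ he₀
  have hlift : ∀ s ∈ Icc 0 f.length, f.unitSpeed.vel s = Complex.exp (Γ s * Complex.I) := by
    intro s hs
    have h := congrArg (fun z : Circle => (z : ℂ)) (congrFun hΓ s)
    simp only [Function.comp, Circle.coe_exp] at h
    rw [h]
    change f.unitSpeed.vel s = f.unitSpeed.vel (projIcc 0 f.length hL.le s)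
    rw [projIcc_of_mem hL.le hs]
  refine ⟨Γ, ?_, hlift⟩
  have huc : UniformContinuousOn Γ (Icc 0 f.length) :=
    isCompact_Icc.uniformContinuousOn_of_continuous Γ.continuous.continuousOn
  obtain ⟨δ, hδ, H⟩ := Metric.uniformContinuousOn_iff.mp huc Real.pi Real.pi_pos
  refine absCont_of_locally_dist_le (g := f.unitSpeed.vel) (K := Real.pi / 2) hδ
    (by positivity) f.unitSpeed.absCont ?_
  rw [uIcc_of_le hL.le]
  intro x hx y hy hxy
  rw [hlift x hx, hlift y hy]
  exact abs_sub_le_of_lift (H x hx y hy hxy).le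

/-- A direction angle of `[f]`; it is unique up to an additive constant in `2πℤ`, which does not
affect any of the notions below. -/
noncomputable def directionAngle (f : PlaneCurve) : ℝ → ℝ := f.exists_isDirectionAngle.choose

/-- The signed curvature of `[f]`, as a function of arc length (defined almost everywhere on
`[0, L]`). -/
noncomputable def signedCurvature (f : PlaneCurve) : ℝ → ℝ := deriv f.directionAngle

theorem intervalIntegrable_signedCurvature (f : PlaneCurve) :
    IntervalIntegrable f.signedCurvature volume 0 f.length :=
  f.exists_isDirectionAngle.choose_spec.1.intervalIntegrable_deriv

/-- The turning angle. -/
noncomputable def turningAngle (f : PlaneCurve) : ℝ := ∫ s in 0..f.length, f.signedCurvature s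

/-- The bending energy `¼ ∫₀ᴸ κ²`, with the value `∞` if `κ` is not square integrable. -/
noncomputable def bendingEnergy (f : PlaneCurve) : ℝ≥0∞ :=
  1 / 4 * ∫⁻ s in Icc 0 f.length, ENNReal.ofReal (f.signedCurvature s ^ 2)

/-- Left-curves turn counter-clockwise only. -/
def IsLeftCurve (f : PlaneCurve) : Prop :=
  ∀ᵐ s ∂volume.restrict (Icc 0 f.length), 0 ≤ f.signedCurvature s

/-- Right-curves turn clockwise only. -/
def IsRightCurve (f : PlaneCurve) : Prop :=
  ∀ᵐ s ∂volume.restrict (Icc 0 f.length), f.signedCurvature s ≤ 0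

/-- A left-curve turning by at most `π`. -/
def IsLeftCCurve (f : PlaneCurve) : Prop := f.IsLeftCurve ∧ |f.turningAngle| ≤ Real.pi

/-- A right-curve turning by at most `π`. -/
def IsRightCCurve (f : PlaneCurve) : Prop := f.IsRightCurve ∧ |f.turningAngle| ≤ Real.pi

/-- A c-curve. -/
def IsCCurve (f : PlaneCurve) : Prop := f.IsLeftCCurve ∨ f.IsRightCCurve

/-- `f ≡ f₁ ⊔ f₂`: the terminal unit tangent vector of `f₁` is the initial one of `f₂`, and the
unit speed curve `[f]` consists of `[f₁]` followed by `[f₂]`. -/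
def IsJoin (f₁ f₂ f : PlaneCurve) : Prop :=
  f₁.terminal = f₂.initial ∧ f.length = f₁.length + f₂.length ∧
    (∀ s ∈ Icc 0 f₁.length, f.unitSpeed.toFun s = f₁.unitSpeed.toFun s) ∧
    ∀ s ∈ Icc 0 f₂.length, f.unitSpeed.toFun (f₁.length + s) = f₂.unitSpeed.toFun s

/-- An s-curve: a c-curve, or a c-curve followed by a c-curve turning in the opposite
direction. -/
def IsSCurve (f : PlaneCurve) : Prop :=
  f.IsCCurve ∨ ∃ f₁ f₂ : PlaneCurve, IsJoin f₁ f₂ f ∧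
    (f₁.IsLeftCCurve ∧ f₂.IsRightCCurve ∨ f₁.IsRightCCurve ∧ f₂.IsLeftCCurve)

end PlaneCurve

/-- The set `S(u, v)` of all s-curves which connect `u` to `v`. -/
def sCurves (u v : UnitTangentVector) : Set PlaneCurve :=
  {f | f.IsSCurve ∧ f.Connects u v}

/-! ### Rectangular elastica -/

/-- The function `ξ` with `ξ(0) = 0` and `ξ' = sin² / √(1 + sin²)`. -/
noncomputable def elasticaXi (t : ℝ) : ℝ :=
  ∫ r in 0..t, Real.sin r ^ 2 / Real.sqrt (1 + Real.sin r ^ 2)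

/-- The rectangular elastica `E(t) = sin t + i ξ(t)`. -/
noncomputable def elastica (t : ℝ) : ℂ := Real.sin t + elasticaXi t * Complex.I

theorem continuous_elasticaXi_integrand :
    Continuous fun r : ℝ => Real.sin r ^ 2 / Real.sqrt (1 + Real.sin r ^ 2) := by
  refine Continuous.div (by fun_prop) (by fun_prop) fun r => ?_
  exact (Real.sqrt_pos.mpr (by positivity)).ne'

theorem hasDerivAt_elasticaXi (t : ℝ) :
    HasDerivAt elasticaXi (Real.sin t ^ 2 / Real.sqrt (1 + Real.sin t ^ 2)) t :=
  intervalIntegral.integral_hasDerivAt_right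
    (continuous_elasticaXi_integrand.intervalIntegrable _ _)
    (continuous_elasticaXi_integrand.stronglyMeasurableAtFilter _ _)
    continuous_elasticaXi_integrand.continuousAt

theorem hasDerivAt_elastica (t : ℝ) :
    HasDerivAt elastica (Real.cos t +
      ((Real.sin t ^ 2 / Real.sqrt (1 + Real.sin t ^ 2) : ℝ) : ℂ) * Complex.I) t :=
  (Real.hasDerivAt_sin t).ofReal_comp.add
    ((hasDerivAt_elasticaXi t).ofReal_comp.mul_const Complex.I)

theorem deriv_elastica_ne_zero (t : ℝ) : deriv elastica t ≠ 0 := by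
  rw [(hasDerivAt_elastica t).deriv]
  intro h
  have hre := congrArg Complex.re h
  have him := congrArg Complex.im h
  simp only [Complex.add_re, Complex.add_im, Complex.mul_re, Complex.mul_im, Complex.ofReal_re,
    Complex.ofReal_im, Complex.I_re, Complex.I_im, Complex.zero_re, Complex.zero_im] at hre him
  have h1 : Real.sin t ^ 2 = 1 := by nlinarith [Real.sin_sq_add_cos_sq t]
  rw [h1] at him
  have : (0 : ℝ) < 1 / Real.sqrt (1 + 1) := by positivity
  linarith

theorem contDiff_deriv_elastica : ContDiff ℝ 1 (deriv elastica) := by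
  have h : deriv elastica = fun t : ℝ => ((Real.cos t : ℝ) : ℂ) +
      ((Real.sin t ^ 2 / Real.sqrt (1 + Real.sin t ^ 2) : ℝ) : ℂ) * Complex.I :=
    funext fun t => (hasDerivAt_elastica t).deriv
  rw [h]
  have h1 : ContDiff ℝ 1 fun t : ℝ => Real.sin t ^ 2 / Real.sqrt (1 + Real.sin t ^ 2) := by
    refine ContDiff.div (Real.contDiff_sin.pow 2) (ContDiff.sqrt (by
      exact contDiff_const.add (Real.contDiff_sin.pow 2)) fun t => by positivity) fun t => ?_
    exact (Real.sqrt_pos.mpr (by positivity)).ne'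
  exact (Complex.ofRealCLM.contDiff.comp Real.contDiff_cos).add
    ((Complex.ofRealCLM.contDiff.comp h1).mul contDiff_const)

theorem derivWithin_elastica {t₁ t₂ : ℝ} (h : t₁ < t₂) {t : ℝ} (ht : t ∈ Icc t₁ t₂) :
    derivWithin elastica (Icc t₁ t₂) t = deriv elastica t :=
  (hasDerivAt_elastica t).differentiableAt.derivWithin (uniqueDiffOn_Icc h t ht)

/-- The sub-curve `E_{[t₁, t₂]}` of the rectangular elastica. -/
noncomputable def elasticaSegment (t₁ t₂ : ℝ) (h : t₁ < t₂) : PlaneCurve where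
  a := t₁
  b := t₂
  lt := h
  toFun := elastica
  differentiableOn := fun t _ => (hasDerivAt_elastica t).differentiableAt.differentiableWithinAt
  absCont := by
    refine absCont_of_locally_dist_le (δ₀ := 1) (K := 1) one_pos zero_le_one
      (contDiff_deriv_elastica.contDiffOn.absolutelyContinuousOnInterval) ?_
    rw [uIcc_of_le h.le]
    intro x hx y hy _
    rw [derivWithin_elastica h hx, derivWithin_elastica h hy, one_mul]
  ne_zero := fun t ht => by
    rw [derivWithin_elastica h ht]
    exact deriv_elastica_ne_zero t

/-- The unit tangent vector `TE(t) = (E(t), E'(t)/|E'(t)|)`. -/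
noncomputable def elasticaTangent (t : ℝ) : UnitTangentVector where
  pos := elastica t
  dir := deriv elastica t / (‖deriv elastica t‖ : ℂ)
  norm_dir := by
    have h : ‖deriv elastica t‖ ≠ 0 := norm_ne_zero_iff.mpr (deriv_elastica_ne_zero t)
    rw [norm_div, Complex.norm_real, norm_norm, div_self h]

/-! ### Absolutely continuous functions -/

/-! The proof is a calibration. Let `τ` be the direction angle and `P` the primitive of `√ sin`.
Where `sin τ ≥ 0`, expanding `(κ/2 - √ sin τ)² ≥ 0` gives `κ²/4 ≥ √(sin τ) κ - sin τ`. The right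
side integrates to `P(θ₂) - P(θ₁)` minus the height gained, which depends only on the end data. On
the elastica `x = √ sin τ` and `y = P(τ)/2` up to constants and `κ = 2x`, so there the bound is an
equality and the energy is the height.

This settles competitors whose angle stays in `[0, π]`. An s-curve changes its sense of turning at
most once, so otherwise it overshoots `π` or `0` at its turning point. Rotating the calibration
until the extreme angle is `π` or `0`, and flipping its sign at the turning point, gives a bound
strictly above the height (`lt_two_mul_sqrtSinPrimitive_pi_sub`, `mem_Icc_or_lt`).

A minimiser therefore has `τ ∈ [0, π]` and `τ' = 2 √(sin τ)` almost everywhere. This equation is not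
Lipschitz at `0` and `π`, where a solution may linger along a straight piece. The prescribed
horizontal displacement and `θ₂ - θ₁ < π` exclude that: `√(sin τ)` equals `x` up to a constant
(`sqrt_sin_eq_add_integral_cos`), and `τ' = 2x`, `x' = cos τ` is a Lipschitz system with a unique
solution. The common end point then forces equal lengths. -/

theorem AbsolutelyContinuousOnInterval.integral_comp_mul_deriv_of_convex {τ P p : ℝ → ℝ}
    {a b K : ℝ} {S : Set ℝ} (hS : Convex ℝ S) (hτ : AbsolutelyContinuousOnInterval τ a b)
    (hmaps : ∀ s ∈ uIcc a b, τ s ∈ S) (hP : ∀ x ∈ S, HasDerivAt P (p x) x)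
    (hK : ∀ x ∈ S, |p x| ≤ K) :
    ∫ s in a..b, p (τ s) * deriv τ s = P (τ b) - P (τ a) := by
  have hK0 : 0 ≤ K := (abs_nonneg _).trans (hK _ (hmaps a left_mem_uIcc))
  -- A bounded derivative on a convex set makes `P` Lipschitz there, so `P ∘ τ` is absolutely
  -- continuous and its derivative integrates back.
  have hac : AbsolutelyContinuousOnInterval (fun s => P (τ s)) a b := by
    refine absCont_of_locally_dist_le one_pos hK0 hτ fun x hx y hy _ => ?_
    rw [dist_eq_norm, dist_eq_norm]
    exact hS.norm_image_sub_le_of_norm_hasDerivWithin_le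
      (fun z hz => (hP z hz).hasDerivWithinAt) (fun z hz => hK z hz) (hmaps y hy) (hmaps x hx)
  rw [← hac.integral_deriv_eq_sub]
  refine intervalIntegral.integral_congr_ae ?_
  filter_upwards [hτ.ae_differentiableAt] with s hs hsm
  have hd := (hs (uIoc_subset_uIcc hsm)).hasDerivAt
  exact ((hP _ (hmaps s (uIoc_subset_uIcc hsm))).comp s hd).deriv.symm

theorem AbsolutelyContinuousOnInterval.monotoneOn_of_ae_deriv_nonneg {τ : ℝ → ℝ} {a b : ℝ}
    (hab : a ≤ b) (hτ : AbsolutelyContinuousOnInterval τ a b)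
    (h : ∀ᵐ s ∂volume.restrict (Icc a b), 0 ≤ deriv τ s) : MonotoneOn τ (Icc a b) := by
  intro x hx y hy hxy
  have hsub : uIcc x y ⊆ uIcc a b := by
    rw [uIcc_of_le hab]; exact uIcc_subset_Icc hx hy
  rw [← sub_nonneg, ← (hτ.mono hsub).integral_deriv_eq_sub]
  refine intervalIntegral.integral_nonneg_of_ae_restrict hxy ?_
  exact ae_restrict_of_ae_restrict_of_subset (Icc_subset_Icc hx.1 hy.2) h

theorem AbsolutelyContinuousOnInterval.antitoneOn_of_ae_deriv_nonpos {τ : ℝ → ℝ} {a b : ℝ}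
    (hab : a ≤ b) (hτ : AbsolutelyContinuousOnInterval τ a b)
    (h : ∀ᵐ s ∂volume.restrict (Icc a b), deriv τ s ≤ 0) : AntitoneOn τ (Icc a b) := by
  have hm := hτ.neg.monotoneOn_of_ae_deriv_nonneg hab (by
    filter_upwards [h] with s hs
    rw [deriv.neg]
    simpa using hs)
  intro x hx y hy hxy
  have := hm hx hy hxy
  simp only [Pi.neg_apply] at this
  linarith

/-! ### The primitive of `√ sin` -/

/-- The primitive of `√ sin` which vanishes at `0`. -/
noncomputable def sqrtSinPrimitive (φ : ℝ) : ℝ := ∫ r in 0..φ, √(Real.sin r)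

theorem continuous_sqrt_sin : Continuous fun r : ℝ => √(Real.sin r) := by fun_prop

theorem hasDerivAt_sqrtSinPrimitive (φ : ℝ) :
    HasDerivAt sqrtSinPrimitive (√(Real.sin φ)) φ :=
  intervalIntegral.integral_hasDerivAt_right (continuous_sqrt_sin.intervalIntegrable _ _)
    (continuous_sqrt_sin.stronglyMeasurableAtFilter _ _) continuous_sqrt_sin.continuousAt

/-- Monotone on the whole line because `√` vanishes at negative arguments. -/
theorem monotone_sqrtSinPrimitive : Monotone sqrtSinPrimitive :=
  monotone_of_deriv_nonneg (fun φ => (hasDerivAt_sqrtSinPrimitive φ).differentiableAt) fun φ => by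
    rw [(hasDerivAt_sqrtSinPrimitive φ).deriv]; positivity

theorem sqrtSinPrimitive_zero : sqrtSinPrimitive 0 = 0 := by simp [sqrtSinPrimitive]

/-- The symmetry of `sin` about `π/2`. It carries the estimate for overshooting `π` over to
undershooting `0`. -/
theorem sqrtSinPrimitive_pi_sub (φ : ℝ) :
    sqrtSinPrimitive (Real.pi - φ) = sqrtSinPrimitive Real.pi - sqrtSinPrimitive φ := by
  have h : ∀ x, HasDerivAt (fun x => sqrtSinPrimitive (Real.pi - x) + sqrtSinPrimitive x) 0 x := by
    intro x
    have h1 := (hasDerivAt_sqrtSinPrimitive (Real.pi - x)).comp x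
      ((hasDerivAt_id x).const_sub Real.pi)
    have h2 := h1.add (hasDerivAt_sqrtSinPrimitive x)
    rw [Real.sin_pi_sub] at h2
    exact h2.congr_deriv (by ring)
  have h3 := is_const_of_deriv_eq_zero (fun x => (h x).differentiableAt) (fun x => (h x).deriv)
    φ 0
  simp only [sub_zero, sqrtSinPrimitive_zero, add_zero] at h3
  linarith

theorem sqrtSinPrimitive_lt {x y : ℝ} (h0 : 0 ≤ x) (hxy : x < y) (hy : y ≤ Real.pi) :
    sqrtSinPrimitive x < sqrtSinPrimitive y := by
  have h : StrictMonoOn sqrtSinPrimitive (Icc 0 Real.pi) := by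
    refine strictMonoOn_of_deriv_pos (convex_Icc _ _)
      (fun φ _ => (hasDerivAt_sqrtSinPrimitive φ).continuousAt.continuousWithinAt) fun φ hφ => ?_
    rw [interior_Icc] at hφ
    rw [(hasDerivAt_sqrtSinPrimitive φ).deriv]
    exact Real.sqrt_pos.mpr (Real.sin_pos_of_mem_Ioo hφ)
  exact h ⟨h0, by linarith⟩ ⟨by linarith, hy⟩ hxy

/-! ### Trigonometric inequalities for the overshooting case. -/

/-- Write `θ₂ = p θ₁ + q π`. Concavity of `sin` bounds `sin θ₂` and `sin (θ₂ - α)` below by chords,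
and subadditivity bounds `sin θ₁` by `sin (θ₁ - α) + sin α`. What is left over is `2 p sin (θ₁ - α)
≥ 0`. -/
theorem sin_le_sin_sub_add_sin_sub_add_sin {θ₁ θ₂ α : ℝ} (hα : 0 ≤ α) (hα₁ : α ≤ θ₁)
    (h₁₂ : θ₁ ≤ θ₂) (h₂ : θ₂ ≤ Real.pi) :
    Real.sin θ₁ ≤ Real.sin (θ₁ - α) + Real.sin (θ₂ - α) + Real.sin θ₂ := by
  have hpi := Real.pi_pos
  obtain ⟨p, q, hp, hq, hpq, hθ⟩ : ∃ p q : ℝ, 0 ≤ p ∧ 0 ≤ q ∧ p + q = 1 ∧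
      p * θ₁ + q * Real.pi = θ₂ := by
    have : θ₂ ∈ segment ℝ θ₁ Real.pi := by
      rw [segment_eq_Icc (h₁₂.trans h₂)]; exact ⟨h₁₂, h₂⟩
    simpa [segment] using this
  have hc := strictConcaveOn_sin_Icc.concaveOn.2
  have e1 := hc (x := θ₁) (y := Real.pi) ⟨by linarith, by linarith⟩ ⟨hpi.le, le_rfl⟩ hp hq hpq
  have e2 := hc (x := θ₁ - α) (y := Real.pi - α) ⟨by linarith, by linarith⟩
    ⟨by linarith, by linarith⟩ hp hq hpq
  have e3 : p * (θ₁ - α) + q * (Real.pi - α) = θ₂ - α := by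
    linear_combination hθ - α * hpq
  simp only [smul_eq_mul, hθ, e3, Real.sin_pi, Real.sin_pi_sub] at e1 e2
  have hs1 : 0 ≤ Real.sin (θ₁ - α) :=
    Real.sin_nonneg_of_nonneg_of_le_pi (by linarith) (by linarith)
  have hs0 : 0 ≤ Real.sin α := Real.sin_nonneg_of_nonneg_of_le_pi hα (by linarith)
  have h4 : Real.sin θ₁ ≤ Real.sin (θ₁ - α) + Real.sin α := by
    have h5 := Real.sin_add (θ₁ - α) α
    rw [sub_add_cancel] at h5
    have h6 := mul_le_mul_of_nonneg_left (Real.cos_le_one α) hs1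
    have h7 := mul_le_mul_of_nonneg_right (Real.cos_le_one (θ₁ - α)) hs0
    linarith
  have h8 := mul_le_mul_of_nonneg_left h4 hq
  have h9 := mul_nonneg hp hs1
  have h10 : p = 1 - q := by linarith
  subst h10
  nlinarith

/-- Gives the sign of a derivative in the next lemma. In the main case `cos α` is replaced by `1`,
and the square of the resulting inequality follows from the concavity estimate above. -/
theorem cos_mul_sqrt_sin_sub_le {θ₁ θ₂ α : ℝ} (hα : 0 ≤ α) (hα₁ : α ≤ θ₁) (h₁₂ : θ₁ ≤ θ₂)
    (h₂ : θ₂ ≤ Real.pi) :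
    Real.cos α * (√(Real.sin θ₁) - √(Real.sin θ₂)) ≤
      √(Real.sin (θ₁ - α)) + √(Real.sin (θ₂ - α)) := by
  have hpi := Real.pi_pos
  rcases le_or_gt (√(Real.sin θ₁)) (√(Real.sin θ₂)) with hle | hlt
  · rcases le_or_gt α (Real.pi / 2) with hα2 | hα2
    · have hc := Real.cos_nonneg_of_mem_Icc ⟨by linarith, hα2⟩
      have : Real.cos α * (√(Real.sin θ₁) - √(Real.sin θ₂)) ≤ 0 :=
        mul_nonpos_of_nonneg_of_nonpos hc (by linarith)
      have h3 := Real.sqrt_nonneg (Real.sin (θ₁ - α))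
      have h4 := Real.sqrt_nonneg (Real.sin (θ₂ - α))
      linarith
    -- Now both angles lie in `[π/2, π]`, where `sin` decreases, so the two square roots coincide
    -- and the left side is zero.
    · have h5 : Real.sin θ₂ ≤ Real.sin θ₁ := by
        rw [← Real.cos_sub_pi_div_two, ← Real.cos_sub_pi_div_two]
        exact Real.cos_le_cos_of_nonneg_of_le_pi (by linarith) (by linarith) (by linarith)
      have h6 : √(Real.sin θ₁) = √(Real.sin θ₂) := le_antisymm hle (Real.sqrt_le_sqrt h5)
      rw [h6, sub_self, mul_zero]
      positivity
  · have hc1 : Real.cos α * (√(Real.sin θ₁) - √(Real.sin θ₂)) ≤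
        √(Real.sin θ₁) - √(Real.sin θ₂) := by
      have := mul_le_mul_of_nonneg_right (Real.cos_le_one α) (sub_nonneg.mpr hlt.le)
      linarith
    refine hc1.trans ?_
    have hs1 : 0 ≤ Real.sin (θ₁ - α) :=
      Real.sin_nonneg_of_nonneg_of_le_pi (by linarith) (by linarith)
    have hs2 : 0 ≤ Real.sin (θ₂ - α) :=
      Real.sin_nonneg_of_nonneg_of_le_pi (by linarith) (by linarith)
    have ht2 : 0 ≤ Real.sin θ₂ := Real.sin_nonneg_of_nonneg_of_le_pi (by linarith) h₂
    have ht1 : 0 ≤ Real.sin θ₁ :=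
      Real.sin_nonneg_of_nonneg_of_le_pi (by linarith) (by linarith)
    have key : Real.sin θ₁ ≤ Real.sin (θ₁ - α) + Real.sin (θ₂ - α) + Real.sin θ₂ :=
      sin_le_sin_sub_add_sin_sub_add_sin hα hα₁ h₁₂ h₂
    have h7 : Real.sin θ₁ ≤
        (√(Real.sin (θ₁ - α)) + √(Real.sin (θ₂ - α)) + √(Real.sin θ₂)) ^ 2 := by
      nlinarith [Real.sq_sqrt hs1, Real.sq_sqrt hs2, Real.sq_sqrt ht2,
        Real.sqrt_nonneg (Real.sin (θ₁ - α)), Real.sqrt_nonneg (Real.sin (θ₂ - α)),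
        Real.sqrt_nonneg (Real.sin θ₂),
        mul_nonneg (Real.sqrt_nonneg (Real.sin (θ₁ - α))) (Real.sqrt_nonneg (Real.sin (θ₂ - α))),
        mul_nonneg (Real.sqrt_nonneg (Real.sin (θ₁ - α))) (Real.sqrt_nonneg (Real.sin θ₂)),
        mul_nonneg (Real.sqrt_nonneg (Real.sin (θ₂ - α))) (Real.sqrt_nonneg (Real.sin θ₂))]
    have := Real.sqrt_le_iff.mpr ⟨by positivity, h7⟩
    linarith

/-- The left side is the height of the elastica arc, the right side the calibration bound for a
curve overshooting `π` by `α`. As a function of `α` the right side is strictly increasing, and at `α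
= 0` it is already at least the left side. -/
theorem lt_two_mul_sqrtSinPrimitive_pi_sub {θ₁ θ₂ α : ℝ} (hα : 0 < α) (hα₁ : α ≤ θ₁)
    (h₁₂ : θ₁ < θ₂) (h₂ : θ₂ ≤ Real.pi) :
    (sqrtSinPrimitive θ₂ - sqrtSinPrimitive θ₁) / 2 <
      2 * sqrtSinPrimitive Real.pi - sqrtSinPrimitive (θ₁ - α) - sqrtSinPrimitive (θ₂ - α) -
        (Real.cos α * ((sqrtSinPrimitive θ₂ - sqrtSinPrimitive θ₁) / 2) -
          Real.sin α * (√(Real.sin θ₂) - √(Real.sin θ₁))) := by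
  set Δ := (sqrtSinPrimitive θ₂ - sqrtSinPrimitive θ₁) / 2 with hΔ
  set d := √(Real.sin θ₂) - √(Real.sin θ₁) with hd
  have hΔ0 : 0 < Δ := by
    have := sqrtSinPrimitive_lt (hα.le.trans hα₁) h₁₂ h₂
    rw [hΔ]; linarith
  set h : ℝ → ℝ := fun α => 2 * sqrtSinPrimitive Real.pi - sqrtSinPrimitive (θ₁ - α) -
    sqrtSinPrimitive (θ₂ - α) - (Real.cos α * Δ - Real.sin α * d) with hh
  have hder : ∀ x, HasDerivAt h (√(Real.sin (θ₁ - x)) + √(Real.sin (θ₂ - x)) +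
      Real.sin x * Δ + Real.cos x * d) x := by
    intro x
    have h1 := (hasDerivAt_sqrtSinPrimitive (θ₁ - x)).comp x ((hasDerivAt_id x).const_sub θ₁)
    have h2 := (hasDerivAt_sqrtSinPrimitive (θ₂ - x)).comp x ((hasDerivAt_id x).const_sub θ₂)
    have h3 := ((h1.const_sub (2 * sqrtSinPrimitive Real.pi)).sub h2).sub
      (((Real.hasDerivAt_cos x).mul_const Δ).sub ((Real.hasDerivAt_sin x).mul_const d))
    exact h3.congr_deriv (by ring)
  have hmono : StrictMonoOn h (Icc 0 θ₁) := by
    refine strictMonoOn_of_deriv_pos (convex_Icc _ _)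
      (fun x _ => (hder x).continuousAt.continuousWithinAt) fun x hx => ?_
    rw [interior_Icc] at hx
    rw [(hder x).deriv]
    have h1 := cos_mul_sqrt_sin_sub_le hx.1.le hx.2.le h₁₂.le h₂
    have h2 : 0 < Real.sin x * Δ :=
      mul_pos (Real.sin_pos_of_pos_of_lt_pi hx.1 (by linarith [hx.2])) hΔ0
    have h3 : Real.cos x * d = - (Real.cos x * (√(Real.sin θ₁) - √(Real.sin θ₂))) := by
      rw [hd]; ring
    linarith
  -- The difference is `2 (P(π) - P(θ₂))`.
  have h0 : Δ ≤ h 0 := by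
    have := monotone_sqrtSinPrimitive h₂
    simp only [hh, sub_zero, Real.cos_zero, Real.sin_zero, hΔ]
    linarith
  exact h0.trans_lt (hmono ⟨le_rfl, hα.le.trans hα₁⟩ ⟨hα.le, hα₁⟩ hα)

/-! ### The calibration inequality -/

/-- Integrability of `k` is not assumed, so that curves of infinite bending energy are covered. -/
theorem ofReal_integral_le_lintegral_ofReal {X : Type*} [MeasurableSpace X] {μ : Measure X}
    {h k : X → ℝ} (hh : Integrable h μ) (hk : AEStronglyMeasurable k μ) (hk0 : 0 ≤ᵐ[μ] k)
    (hle : h ≤ᵐ[μ] k) : ENNReal.ofReal (∫ x, h x ∂μ) ≤ ∫⁻ x, ENNReal.ofReal (k x) ∂μ := by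
  by_cases htop : ∫⁻ x, ENNReal.ofReal (k x) ∂μ = ∞
  · rw [htop]; exact le_top
  · have hki : Integrable k μ := (lintegral_ofReal_ne_top_iff_integrable hk hk0).mp htop
    rw [← ofReal_integral_eq_lintegral_ofReal hki hk0]
    exact ENNReal.ofReal_le_ofReal (integral_mono_ae hh hki hle)

/-- The sign condition on the integral of `h` is needed because `ENNReal.ofReal` truncates negative
values and would hide a strict inequality. -/
theorem ae_eq_of_lintegral_ofReal_le {X : Type*} [MeasurableSpace X] {μ : Measure X}
    {h k : X → ℝ} (hh : Integrable h μ) (hk : AEStronglyMeasurable k μ) (hk0 : 0 ≤ᵐ[μ] k)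
    (hle : h ≤ᵐ[μ] k) (h0 : 0 ≤ ∫ x, h x ∂μ)
    (heq : ∫⁻ x, ENNReal.ofReal (k x) ∂μ ≤ ENNReal.ofReal (∫ x, h x ∂μ)) : h =ᵐ[μ] k := by
  have hki : Integrable k μ := (lintegral_ofReal_ne_top_iff_integrable hk hk0).mp
    (heq.trans_lt ENNReal.ofReal_lt_top).ne
  rw [← ofReal_integral_eq_lintegral_ofReal hki hk0, ENNReal.ofReal_le_ofReal_iff h0] at heq
  exact (integral_eq_iff_of_ae_le hh hki hle).mp
    (le_antisymm (integral_mono_ae hh hki hle) heq)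

theorem one_div_four_mul_lintegral_sq (κ : ℝ → ℝ) (μ : Measure ℝ) :
    1 / 4 * ∫⁻ s, ENNReal.ofReal (κ s ^ 2) ∂μ = ∫⁻ s, ENNReal.ofReal (κ s ^ 2 / 4) ∂μ := by
  rw [← lintegral_const_mul' _ _ (by simp)]
  refine lintegral_congr fun s => ?_
  rw [div_eq_mul_inv (κ s ^ 2), mul_comm, ENNReal.ofReal_mul (by positivity),
    ENNReal.ofReal_inv_of_pos (by norm_num), one_div]
  norm_num

section Calibration

variable {τ : ℝ → ℝ} {a b α σ : ℝ}

theorem integrableOn_calibration (hab : a ≤ b) (hτ : AbsolutelyContinuousOnInterval τ a b)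
    (σ α : ℝ) :
    IntegrableOn (fun s => σ * (√(Real.sin (τ s - α)) * deriv τ s) - Real.sin (τ s - α))
      (Icc a b) := by
  have hc := hτ.continuousOn
  rw [← intervalIntegrable_iff_integrableOn_Icc_of_le hab]
  refine ((hτ.intervalIntegrable_deriv.continuousOn_mul ?_).const_mul σ).sub
    (ContinuousOn.intervalIntegrable ?_)
  · exact continuous_sqrt_sin.comp_continuousOn (hc.sub continuousOn_const)
  · exact Real.continuous_sin.comp_continuousOn (hc.sub continuousOn_const)

/-- The first term is an exact derivative and the second is the component of the displacement normal
to the direction `α`, so the calibration sees only end angles and end points. -/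
theorem integral_calibration (hab : a ≤ b) (hτ : AbsolutelyContinuousOnInterval τ a b)
    (σ α : ℝ) :
    ∫ s in Icc a b, (σ * (√(Real.sin (τ s - α)) * deriv τ s) - Real.sin (τ s - α)) =
      σ * (sqrtSinPrimitive (τ b - α) - sqrtSinPrimitive (τ a - α)) -
        ∫ s in a..b, Real.sin (τ s - α) := by
  have hc := hτ.continuousOn
  rw [integral_Icc_eq_integral_Ioc, ← intervalIntegral.integral_of_le hab,
    intervalIntegral.integral_sub, intervalIntegral.integral_const_mul]
  · rw [AbsolutelyContinuousOnInterval.integral_comp_mul_deriv_of_convex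
      (p := fun x => √(Real.sin (x - α))) (P := fun x => sqrtSinPrimitive (x - α)) (K := 1)
      convex_univ hτ (fun _ _ => mem_univ _) ?_ ?_]
    · intro x _
      exact ((hasDerivAt_sqrtSinPrimitive (x - α)).comp x
        ((hasDerivAt_id x).sub_const α)).congr_deriv (by ring)
    · intro x _
      rw [abs_of_nonneg (Real.sqrt_nonneg _), Real.sqrt_le_iff, one_pow]
      exact ⟨zero_le_one, Real.sin_le_one _⟩
  · exact (hτ.intervalIntegrable_deriv.continuousOn_mul
      (continuous_sqrt_sin.comp_continuousOn (hc.sub continuousOn_const))).const_mul σ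
  · exact (Real.continuous_sin.comp_continuousOn
      (hc.sub continuousOn_const)).intervalIntegrable

/-- This is the square of `κ / 2 - σ √u`, so equality means `κ = 2 σ √u`. -/
theorem calibration_pointwise_le {κ u : ℝ} (hσ : σ ^ 2 = 1) (hu : 0 ≤ u) :
    σ * (√u * κ) - u ≤ κ ^ 2 / 4 := by
  have h := sq_nonneg (κ / 2 - σ * √u)
  have h2 := Real.sq_sqrt hu
  nlinarith

/-- Here `α` rotates the frame so that the angle has nonnegative sine, and the sign `σ` selects the
sense of turning. -/
theorem calibration_le (hab : a ≤ b) (hτ : AbsolutelyContinuousOnInterval τ a b)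
    (hσ : σ ^ 2 = 1) (hα : ∀ s ∈ Icc a b, 0 ≤ Real.sin (τ s - α)) :
    ENNReal.ofReal (σ * (sqrtSinPrimitive (τ b - α) - sqrtSinPrimitive (τ a - α)) -
        ∫ s in a..b, Real.sin (τ s - α)) ≤
      ∫⁻ s in Icc a b, ENNReal.ofReal (deriv τ s ^ 2 / 4) := by
  rw [← integral_calibration hab hτ]
  refine ofReal_integral_le_lintegral_ofReal (integrableOn_calibration hab hτ σ α)
    (((measurable_deriv τ).pow_const 2).div_const 4).aestronglyMeasurable
    (Eventually.of_forall fun s => by positivity) ?_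
  exact (ae_restrict_iff' measurableSet_Icc).mpr
    (Eventually.of_forall fun s hs => calibration_pointwise_le hσ (hα s hs))

/-- Equality in the calibration inequality forces the curvature to be `2 √ sin τ`. -/
theorem deriv_eq_of_calibration_eq (hab : a ≤ b) (hτ : AbsolutelyContinuousOnInterval τ a b)
    (hα : ∀ s ∈ Icc a b, 0 ≤ Real.sin (τ s))
    (h0 : 0 ≤ sqrtSinPrimitive (τ b) - sqrtSinPrimitive (τ a) - ∫ s in a..b, Real.sin (τ s))
    (hle : ∫⁻ s in Icc a b, ENNReal.ofReal (deriv τ s ^ 2 / 4) ≤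
      ENNReal.ofReal (sqrtSinPrimitive (τ b) - sqrtSinPrimitive (τ a) -
        ∫ s in a..b, Real.sin (τ s))) :
    ∀ᵐ s ∂volume.restrict (Icc a b), deriv τ s = 2 * √(Real.sin (τ s)) := by
  have hi := integral_calibration hab hτ 1 0
  have hint := integrableOn_calibration hab hτ 1 0
  simp only [sub_zero, one_mul] at hi hint
  rw [← hi] at h0 hle
  have hmem : ∀ᵐ s ∂volume.restrict (Icc a b), s ∈ Icc a b := ae_restrict_mem measurableSet_Icc
  have hae := ae_eq_of_lintegral_ofReal_le hint
    (((measurable_deriv τ).pow_const 2).div_const 4).aestronglyMeasurable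
    (Eventually.of_forall fun s => by positivity) (by
      filter_upwards [hmem] with s hs
      have := calibration_pointwise_le (κ := deriv τ s) (one_pow 2) (hα s hs)
      rwa [one_mul] at this) h0 hle
  filter_upwards [hae, hmem] with s hs hs'
  have h2 := Real.sq_sqrt (hα s hs')
  -- The gap in the pointwise inequality is exactly this square.
  have h3 : (deriv τ s / 2 - √(Real.sin (τ s))) ^ 2 = 0 := by
    rw [sub_sq, h2]; linear_combination -hs
  have := pow_eq_zero_iff (two_ne_zero) |>.mp h3
  linarith

/-- Expresses the displacement in the rotated frame through the two components fixed by the end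
points. -/
theorem integral_sin_sub (hτ : ContinuousOn τ (uIcc a b)) (α : ℝ) :
    ∫ s in a..b, Real.sin (τ s - α) =
      Real.cos α * (∫ s in a..b, Real.sin (τ s)) - Real.sin α * ∫ s in a..b, Real.cos (τ s) := by
  rw [← intervalIntegral.integral_const_mul, ← intervalIntegral.integral_const_mul,
    ← intervalIntegral.integral_sub]
  · refine intervalIntegral.integral_congr fun s _ => ?_
    simp only [Real.sin_sub]
    ring
  · exact ((Real.continuous_sin.comp_continuousOn hτ).intervalIntegrable).const_mul _
  · exact ((Real.continuous_cos.comp_continuousOn hτ).intervalIntegrable).const_mul _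

/-- The calibration inequality for a curve which turns in the sense of `σ` and then in the
opposite sense. -/
theorem calibration_le_of_turn {c : ℝ} (hac : a ≤ c) (hcb : c ≤ b)
    (hτ : AbsolutelyContinuousOnInterval τ a b) (hσ : σ ^ 2 = 1)
    (hα : ∀ s ∈ Icc a b, 0 ≤ Real.sin (τ s - α)) :
    ENNReal.ofReal (σ * (2 * sqrtSinPrimitive (τ c - α) - sqrtSinPrimitive (τ a - α) -
        sqrtSinPrimitive (τ b - α)) - (Real.cos α * (∫ s in a..b, Real.sin (τ s)) -
          Real.sin α * ∫ s in a..b, Real.cos (τ s))) ≤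
      ∫⁻ s in Icc a b, ENNReal.ofReal (deriv τ s ^ 2 / 4) := by
  have hab := hac.trans hcb
  have hc := hτ.continuousOn
  have s1 : uIcc a c ⊆ uIcc a b := by
    rw [uIcc_of_le hab, uIcc_of_le hac]; exact Icc_subset_Icc_right hcb
  have s2 : uIcc c b ⊆ uIcc a b := by
    rw [uIcc_of_le hab, uIcc_of_le hcb]; exact Icc_subset_Icc_left hac
  have h1 := calibration_le hac (hτ.mono s1) hσ
    fun s hs => hα s (Icc_subset_Icc_right hcb hs)
  have h2 := calibration_le (σ := -σ) hcb (hτ.mono s2) (by rw [neg_sq, hσ])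
    fun s hs => hα s (Icc_subset_Icc_left hac hs)
  rw [← integral_sin_sub hc, ← intervalIntegral.integral_add_adjacent_intervals (b := c)]
  · have hsplit : ∫⁻ s in Icc a b, ENNReal.ofReal (deriv τ s ^ 2 / 4) =
        (∫⁻ s in Icc a c, ENNReal.ofReal (deriv τ s ^ 2 / 4)) +
          ∫⁻ s in Icc c b, ENNReal.ofReal (deriv τ s ^ 2 / 4) := by
      rw [← Icc_union_Ioc_eq_Icc hac hcb, lintegral_union measurableSet_Ioc
        (by rw [Set.disjoint_left]; exact fun x hx hx' => hx'.1.not_ge hx.2),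
        restrict_Ioc_eq_restrict_Icc]
    rw [hsplit]
    refine le_trans ?_ (add_le_add h1 h2)
    -- Subadditivity of `ENNReal.ofReal` suffices, so neither piece need have a nonnegative bound.
    refine le_trans (ENNReal.ofReal_le_ofReal ?_) ENNReal.ofReal_add_le
    linarith
  · exact (Real.continuous_sin.comp_continuousOn
      ((hc.mono s1).sub continuousOn_const)).intervalIntegrable
  · exact (Real.continuous_sin.comp_continuousOn
      ((hc.mono s2).sub continuousOn_const)).intervalIntegrable

end Calibration

/-! ### Minimality among direction angles with one change of monotonicity -/

/-- `τ` is the direction angle of an s-curve of length `L` which turns from `θ₁` to `θ₂` and has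
the same end points as the corresponding piece of the rectangular elastica. -/
structure IsAdmissibleAngle (θ₁ θ₂ L : ℝ) (τ : ℝ → ℝ) : Prop where
  length_nonneg : 0 ≤ L
  absCont : AbsolutelyContinuousOnInterval τ 0 L
  left : τ 0 = θ₁
  right : τ L = θ₂
  integral_sin : ∫ s in 0..L, Real.sin (τ s) = (sqrtSinPrimitive θ₂ - sqrtSinPrimitive θ₁) / 2
  integral_cos : ∫ s in 0..L, Real.cos (τ s) = √(Real.sin θ₂) - √(Real.sin θ₁)
  -- For `θ₁ < θ₂` the arc that turns more is the first one in the first alternative and the second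
  -- one in the second; only the bound on that arc is kept.
  turn : ∃ c ∈ Icc 0 L,
    (MonotoneOn τ (Icc 0 c) ∧ AntitoneOn τ (Icc c L) ∧ τ c ≤ θ₁ + Real.pi) ∨
      (AntitoneOn τ (Icc 0 c) ∧ MonotoneOn τ (Icc c L) ∧ θ₂ - Real.pi ≤ τ c)

namespace IsAdmissibleAngle

variable {θ₁ θ₂ L : ℝ} {τ : ℝ → ℝ}

/-- The extreme angle beyond `θ₁` and `θ₂` is attained at the turning point `c`. Either it lies in
`[0, π]`, and then so does everything, or the calibration rotated to fit the overshoot wins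
strictly. -/
theorem mem_Icc_or_lt (h : IsAdmissibleAngle θ₁ θ₂ L τ) (h₁ : 0 ≤ θ₁) (h₁₂ : θ₁ < θ₂)
    (h₂ : θ₂ ≤ Real.pi) :
    (∀ s ∈ Icc 0 L, τ s ∈ Icc 0 Real.pi) ∨
      ENNReal.ofReal ((sqrtSinPrimitive θ₂ - sqrtSinPrimitive θ₁) / 2) <
        ∫⁻ s in Icc 0 L, ENNReal.ofReal (deriv τ s ^ 2 / 4) := by
  have hpos := sqrtSinPrimitive_lt h₁ h₁₂ h₂
  obtain ⟨c, hc, hturn⟩ := h.turn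
  have hl := h.left
  have hr := h.right
  have hpi := Real.pi_pos
  have hlin : ∀ {x : ℝ}, (sqrtSinPrimitive θ₂ - sqrtSinPrimitive θ₁) / 2 < x →
      ENNReal.ofReal x ≤ ∫⁻ s in Icc 0 L, ENNReal.ofReal (deriv τ s ^ 2 / 4) →
      ENNReal.ofReal ((sqrtSinPrimitive θ₂ - sqrtSinPrimitive θ₁) / 2) <
        ∫⁻ s in Icc 0 L, ENNReal.ofReal (deriv τ s ^ 2 / 4) := fun hx hle =>
    lt_of_lt_of_le ((ENNReal.ofReal_lt_ofReal_iff (by linarith)).mpr hx) hle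
  have m0 : (0 : ℝ) ∈ Icc 0 c := ⟨le_rfl, hc.1⟩
  have mc : c ∈ Icc 0 c := ⟨hc.1, le_rfl⟩
  have mc' : c ∈ Icc c L := ⟨le_rfl, hc.2⟩
  have mL : L ∈ Icc c L := ⟨hc.2, le_rfl⟩
  rcases hturn with ⟨hm, ha, hlim⟩ | ⟨ha, hm, hlim⟩
  · have hrange : ∀ s ∈ Icc 0 L, θ₁ ≤ τ s ∧ τ s ≤ τ c := by
      intro s hs
      rcases le_total s c with hsc | hsc
      · exact ⟨hl ▸ hm m0 ⟨hs.1, hsc⟩ hs.1, hm ⟨hs.1, hsc⟩ mc hsc⟩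
      · exact ⟨h₁₂.le.trans (hr ▸ ha ⟨hsc, hs.2⟩ mL hs.2), ha mc' ⟨hsc, hs.2⟩ hsc⟩
    have hcθ₂ : θ₂ ≤ τ c := hr ▸ ha mc' mL hc.2
    rcases le_or_gt (τ c) Real.pi with hle | hgt
    · exact Or.inl fun s hs => ⟨h₁.trans (hrange s hs).1, (hrange s hs).2.trans hle⟩
    · right
      -- The rotation puts the top of the range at `π`; the bound on turning keeps the bottom
      -- nonnegative.
      have hα : ∀ s ∈ Icc 0 L, 0 ≤ Real.sin (τ s - (τ c - Real.pi)) := by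
        intro s hs
        obtain ⟨h3, h4⟩ := hrange s hs
        exact Real.sin_nonneg_of_nonneg_of_le_pi (by linarith) (by linarith)
      have hcal := calibration_le_of_turn (σ := 1) hc.1 hc.2 h.absCont (one_pow 2) hα
      rw [h.integral_sin, h.integral_cos, hl, hr, sub_sub_cancel, one_mul] at hcal
      exact hlin (lt_two_mul_sqrtSinPrimitive_pi_sub (by linarith) (by linarith) h₁₂ h₂)
        hcal
  · have hrange : ∀ s ∈ Icc 0 L, τ c ≤ τ s ∧ τ s ≤ θ₂ := by
      intro s hs
      rcases le_total s c with hsc | hsc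
      · exact ⟨ha ⟨hs.1, hsc⟩ mc hsc, (hl ▸ ha m0 ⟨hs.1, hsc⟩ hs.1 : τ s ≤ θ₁).trans h₁₂.le⟩
      · exact ⟨hm mc' ⟨hsc, hs.2⟩ hsc, hr ▸ hm ⟨hsc, hs.2⟩ mL hs.2⟩
    have hcθ₁ : τ c ≤ θ₁ := hl ▸ ha m0 mc hc.1
    rcases le_or_gt 0 (τ c) with hle | hgt
    · exact Or.inl fun s hs => ⟨hle.trans (hrange s hs).1, (hrange s hs).2.trans h₂⟩
    · right
      have hα : ∀ s ∈ Icc 0 L, 0 ≤ Real.sin (τ s - τ c) := by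
        intro s hs
        obtain ⟨h3, h4⟩ := hrange s hs
        exact Real.sin_nonneg_of_nonneg_of_le_pi (by linarith) (by linarith)
      have hcal := calibration_le_of_turn (σ := -1) hc.1 hc.2 h.absCont (by norm_num) hα
      rw [h.integral_sin, h.integral_cos, hl, hr, sub_self, sqrtSinPrimitive_zero] at hcal
      -- The reflection `θ ↦ π - θ` exchanges the roles of the end angles and turns undershooting
      -- `0` by `-τ c` into overshooting `π` by the same amount.
      have key := lt_two_mul_sqrtSinPrimitive_pi_sub (θ₁ := Real.pi - θ₂) (θ₂ := Real.pi - θ₁)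
        (α := -τ c) (by linarith) (by linarith) (by linarith) (by linarith)
      have e₁ : Real.pi - θ₁ - -τ c = Real.pi - (θ₁ - τ c) := by ring
      have e₂ : Real.pi - θ₂ - -τ c = Real.pi - (θ₂ - τ c) := by ring
      rw [e₁, e₂] at key
      simp only [sqrtSinPrimitive_pi_sub, Real.sin_pi_sub, Real.cos_neg, Real.sin_neg] at key
      refine hlin ?_ hcal
      linarith

/-- Without overshoot the unrotated calibration gives the increment of `P` minus the height; the
height being half that increment, the height remains. -/
theorem le_energy (h : IsAdmissibleAngle θ₁ θ₂ L τ) (h₁ : 0 ≤ θ₁) (h₁₂ : θ₁ < θ₂)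
    (h₂ : θ₂ ≤ Real.pi) :
    ENNReal.ofReal ((sqrtSinPrimitive θ₂ - sqrtSinPrimitive θ₁) / 2) ≤
      ∫⁻ s in Icc 0 L, ENNReal.ofReal (deriv τ s ^ 2 / 4) := by
  rcases h.mem_Icc_or_lt h₁ h₁₂ h₂ with hr | hlt
  · have hcal := calibration_le (α := 0) (σ := 1) h.length_nonneg h.absCont (one_pow 2)
      fun s hs => by
        rw [sub_zero]
        exact Real.sin_nonneg_of_mem_Icc (hr s hs)
    simp only [sub_zero, one_mul, h.integral_sin, h.left, h.right] at hcal
    convert hcal using 2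
    ring
  · exact hlt.le

theorem deriv_eq_of_energy_le (h : IsAdmissibleAngle θ₁ θ₂ L τ) (h₁ : 0 ≤ θ₁) (h₁₂ : θ₁ < θ₂)
    (h₂ : θ₂ ≤ Real.pi)
    (hle : ∫⁻ s in Icc 0 L, ENNReal.ofReal (deriv τ s ^ 2 / 4) ≤
      ENNReal.ofReal ((sqrtSinPrimitive θ₂ - sqrtSinPrimitive θ₁) / 2)) :
    (∀ s ∈ Icc 0 L, τ s ∈ Icc 0 Real.pi) ∧
      ∀ᵐ s ∂volume.restrict (Icc 0 L), deriv τ s = 2 * √(Real.sin (τ s)) := by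
  have hpos := sqrtSinPrimitive_lt h₁ h₁₂ h₂
  have hr := (h.mem_Icc_or_lt h₁ h₁₂ h₂).resolve_right hle.not_gt
  refine ⟨hr, deriv_eq_of_calibration_eq h.length_nonneg h.absCont
    (fun s hs => Real.sin_nonneg_of_mem_Icc (hr s hs)) ?_ ?_⟩
  · rw [h.left, h.right, h.integral_sin]; linarith
  · rw [h.left, h.right, h.integral_sin]
    convert hle using 2
    ring

end IsAdmissibleAngle

/-! ### The differential equation of the rectangular elastica -/

theorem hasDerivWithinAt_integral_Icc {E : Type*} [NormedAddCommGroup E] [NormedSpace ℝ E]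
    [CompleteSpace E] {g : ℝ → E} {L s : ℝ} (hg : ContinuousOn g (Icc 0 L)) (hs : s ∈ Icc 0 L) :
    HasDerivWithinAt (fun x => ∫ r in 0..x, g r) (g s) (Icc 0 L) s := by
  have : Fact (s ∈ Icc 0 L) := ⟨hs⟩
  refine intervalIntegral.integral_hasDerivWithinAt_right
    (hg.mono (uIcc_subset_Icc ⟨le_rfl, hs.1.trans hs.2⟩ hs)).intervalIntegrable
    (t := Icc 0 L) ?_ (hg s hs)
  exact hg.stronglyMeasurableAtFilter_nhdsWithin measurableSet_Icc s

section Elastica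

variable {τ : ℝ → ℝ} {L : ℝ}

/-- On the region where `sin τ > 0` the equation `τ' = 2 √ sin τ` gives `(√ sin τ)' = cos τ`. -/
theorem sqrt_sin_sub_eq_integral (hτ : AbsolutelyContinuousOnInterval τ 0 L)
    (hr : ∀ s ∈ Icc 0 L, τ s ∈ Icc 0 Real.pi)
    (hd : ∀ᵐ s ∂volume.restrict (Icc 0 L), deriv τ s = 2 * √(Real.sin (τ s)))
    {s : ℝ} (hs : s ∈ Icc 0 L) :
    √(Real.sin (τ s)) - √(Real.sin (τ 0)) =
      ∫ r in 0..s, if Real.sin (τ r) = 0 then 0 else Real.cos (τ r) := by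
  have hL : 0 ≤ L := hs.1.trans hs.2
  have hsub : uIcc 0 s ⊆ Icc 0 L := uIcc_subset_Icc ⟨le_rfl, hL⟩ hs
  have hτs : AbsolutelyContinuousOnInterval τ 0 s := hτ.mono (by rwa [uIcc_of_le hL])
  have hc : ContinuousOn τ (uIcc 0 s) := hτs.continuousOn
  have hsin : ∀ r ∈ uIcc 0 s, 0 ≤ Real.sin (τ r) := fun r h =>
    Real.sin_nonneg_of_mem_Icc (hr r (hsub h))
  have hd' : ∀ᵐ r, r ∈ uIoc 0 s → deriv τ r = 2 * √(Real.sin (τ r)) := by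
    have := (ae_restrict_iff' measurableSet_Icc).mp hd
    filter_upwards [this] with r h1 h2
    exact h1 (hsub (uIoc_subset_uIcc h2))
  -- The square root is not differentiable at `0`, so the chain rule is applied to `√(sin + ε)`. As
  -- `ε → 0` the quotient below tends to `1` where `sin τ > 0` and stays `0` where `sin τ = 0`.
  have hε : ∀ ε : ℝ, 0 < ε → √(Real.sin (τ s) + ε) - √(Real.sin (τ 0) + ε) =
      ∫ r in 0..s, Real.cos (τ r) * (√(Real.sin (τ r)) / √(Real.sin (τ r) + ε)) := by
    intro ε hε
    rw [← AbsolutelyContinuousOnInterval.integral_comp_mul_deriv_of_convex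
      (P := fun x => √(Real.sin x + ε)) (p := fun x => Real.cos x / (2 * √(Real.sin x + ε)))
      (K := 1 / (2 * √ε)) (convex_Icc 0 Real.pi) hτs (fun r h => hr r (hsub h)) ?_ ?_]
    · refine intervalIntegral.integral_congr_ae ?_
      filter_upwards [hd'] with r h1 h2
      have : √(Real.sin (τ r) + ε) ≠ 0 :=
        (Real.sqrt_pos.mpr (by linarith [hsin r (uIoc_subset_uIcc h2)])).ne'
      simp only [h1 h2]
      field_simp
    · intro x hx
      have := Real.sin_nonneg_of_mem_Icc hx
      exact ((Real.hasDerivAt_sin x).add_const ε).sqrt (by linarith)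
    · intro x hx
      have := Real.sin_nonneg_of_mem_Icc hx
      rw [abs_div, abs_of_nonneg (by positivity : 0 ≤ 2 * √(Real.sin x + ε))]
      gcongr
      · exact Real.abs_cos_le_one x
      · linarith
  have hlim1 : Tendsto (fun ε : ℝ => √(Real.sin (τ s) + ε) - √(Real.sin (τ 0) + ε)) (𝓝[>] 0)
      (𝓝 (√(Real.sin (τ s)) - √(Real.sin (τ 0)))) := by
    have : Continuous fun ε : ℝ => √(Real.sin (τ s) + ε) - √(Real.sin (τ 0) + ε) := by fun_prop
    simpa using (this.tendsto 0).mono_left (nhdsWithin_le_nhds (s := Ioi 0))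
  have hlim2 : Tendsto (fun ε : ℝ =>
      ∫ r in 0..s, Real.cos (τ r) * (√(Real.sin (τ r)) / √(Real.sin (τ r) + ε))) (𝓝[>] 0)
      (𝓝 (∫ r in 0..s, if Real.sin (τ r) = 0 then 0 else Real.cos (τ r))) := by
    refine intervalIntegral.tendsto_integral_filter_of_dominated_convergence (fun _ => 1) ?_ ?_
      intervalIntegrable_const ?_
    · filter_upwards [self_mem_nhdsWithin] with ε (hε : 0 < ε)
      refine ContinuousOn.aestronglyMeasurable (ContinuousOn.mono (s := uIcc 0 s) ?_
        uIoc_subset_uIcc) measurableSet_uIoc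
      refine (Real.continuous_cos.comp_continuousOn hc).mul (ContinuousOn.div
        (continuous_sqrt_sin.comp_continuousOn hc)
        (((Real.continuous_sin.comp_continuousOn hc).add continuousOn_const).sqrt) fun r h => ?_)
      exact (Real.sqrt_pos.mpr (add_pos_of_nonneg_of_pos (hsin r h) hε)).ne'
    · filter_upwards [self_mem_nhdsWithin] with ε (hε : 0 < ε)
      refine Eventually.of_forall fun r h => ?_
      rw [norm_mul, Real.norm_eq_abs, Real.norm_eq_abs, ← one_mul (1 : ℝ)]
      refine mul_le_mul (Real.abs_cos_le_one _) ?_ (abs_nonneg _) zero_le_one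
      rw [abs_of_nonneg (by positivity)]
      exact div_le_one_of_le₀ (Real.sqrt_le_sqrt (by linarith)) (Real.sqrt_nonneg _)
    · refine Eventually.of_forall fun r h => ?_
      split_ifs with h0
      · simp [h0]
      · have h1 : √(Real.sin (τ r)) ≠ 0 :=
          (Real.sqrt_pos.mpr (lt_of_le_of_ne (hsin r (uIoc_subset_uIcc h)) (Ne.symm h0))).ne'
        have h2 : ContinuousAt (fun ε : ℝ =>
            Real.cos (τ r) * (√(Real.sin (τ r)) / √(Real.sin (τ r) + ε))) 0 := by
          refine continuousAt_const.mul (continuousAt_const.div (by fun_prop) ?_)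
          simpa using h1
        have h3 := h2.tendsto.mono_left (nhdsWithin_le_nhds (s := Ioi 0))
        simpa [div_self h1] using h3
  refine tendsto_nhds_unique hlim1 (hlim2.congr' ?_)
  filter_upwards [self_mem_nhdsWithin] with ε hpos
  exact (hε ε hpos).symm

/-- A curve with `τ' = 2 √ sin τ` whose end points are those of the elastica satisfies
`√ sin τ = x` along the curve. -/
theorem sqrt_sin_eq_add_integral_cos (hτ : AbsolutelyContinuousOnInterval τ 0 L) (hL : 0 ≤ L)
    (hr : ∀ s ∈ Icc 0 L, τ s ∈ Icc 0 Real.pi)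
    (hd : ∀ᵐ s ∂volume.restrict (Icc 0 L), deriv τ s = 2 * √(Real.sin (τ s)))
    (hend : 0 < τ 0 ∨ τ L < Real.pi)
    (hx : ∫ s in 0..L, Real.cos (τ s) = √(Real.sin (τ L)) - √(Real.sin (τ 0)))
    {s : ℝ} (hs : s ∈ Icc 0 L) :
    √(Real.sin (τ s)) = √(Real.sin (τ 0)) + ∫ r in 0..s, Real.cos (τ r) := by
  have hmono : MonotoneOn τ (Icc 0 L) := hτ.monotoneOn_of_ae_deriv_nonneg hL (by
    filter_upwards [hd] with r h
    rw [h]; positivity)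
  have m0 : (0 : ℝ) ∈ Icc 0 L := ⟨le_rfl, hL⟩
  have mL : L ∈ Icc 0 L := ⟨hL, le_rfl⟩
  have hc : ContinuousOn τ (Icc 0 L) := by
    have := hτ.continuousOn
    rwa [uIcc_of_le hL] at this
  set k : ℝ → ℝ := fun r => if Real.sin (τ r) = 0 then 0 else Real.cos (τ r) with hk
  -- `g` is `cos τ` restricted to the set where `sin τ = 0`, the possible straight pieces. Its
  -- integral up to `s` is the defect in the claim.
  set g : ℝ → ℝ := fun r => Real.cos (τ r) - k r with hg
  have hcos : IntervalIntegrable (fun r => Real.cos (τ r)) volume 0 L := by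
    refine ContinuousOn.intervalIntegrable ?_
    rw [uIcc_of_le hL]
    exact Real.continuous_cos.comp_continuousOn hc
  have hkint : IntervalIntegrable k volume 0 L := by
    rw [intervalIntegrable_iff_integrableOn_Icc_of_le hL]
    have hcos' := (intervalIntegrable_iff_integrableOn_Icc_of_le hL).mp hcos
    have hm : NullMeasurableSet {r | Real.sin (τ r) = 0} (volume.restrict (Icc 0 L)) := by
      have : AEMeasurable (fun r => Real.sin (τ r)) (volume.restrict (Icc 0 L)) :=
        (Real.continuous_sin.comp_continuousOn hc).aemeasurable measurableSet_Icc
      exact this.nullMeasurableSet_preimage (measurableSet_singleton 0)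
    refine (hcos'.indicator₀ hm.compl).congr (Eventually.of_forall fun r => ?_)
    by_cases h : Real.sin (τ r) = 0 <;> simp [hk, h, indicator]
  have hgint : IntervalIntegrable g volume 0 L := hcos.sub hkint
  have hsub1 : uIcc 0 s ⊆ uIcc 0 L := by
    rw [uIcc_of_le hL]; exact uIcc_subset_Icc m0 hs
  have hsub2 : uIcc s L ⊆ uIcc 0 L := by
    rw [uIcc_of_le hL]; exact uIcc_subset_Icc hs mL
  have hgs : ∫ r in 0..s, g r = (∫ r in 0..s, Real.cos (τ r)) -
      (√(Real.sin (τ s)) - √(Real.sin (τ 0))) := by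
    rw [sqrt_sin_sub_eq_integral hτ hr hd hs]
    exact intervalIntegral.integral_sub (hcos.mono_set hsub1) (hkint.mono_set hsub1)
  have hgL : ∫ r in 0..L, g r = 0 := by
    have h1 : ∫ r in 0..L, g r = (∫ r in 0..L, Real.cos (τ r)) - ∫ r in 0..L, k r :=
      intervalIntegral.integral_sub hcos hkint
    rw [h1, hx, sqrt_sin_sub_eq_integral hτ hr hd mL, sub_self]
  have hadd := intervalIntegral.integral_add_adjacent_intervals (hgint.mono_set hsub1)
    (hgint.mono_set hsub2)
  have hval : ∀ r ∈ Icc 0 L, g r = 0 ∨ (τ r = 0 ∧ g r = 1) ∨ (τ r = Real.pi ∧ g r = -1) := by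
    intro r h
    by_cases h0 : Real.sin (τ r) = 0
    · obtain ⟨h1, h2⟩ := hr r h
      rcases h1.eq_or_lt with h3 | h3
      · right; left
        simp [hg, hk, ← h3]
      · rcases h2.eq_or_lt with h4 | h4
        · right; right
          simp [hg, hk, h4]
        · exact absurd h0 (Real.sin_pos_of_mem_Ioo ⟨h3, h4⟩).ne'
    · left; simp [hg, hk, h0]
  -- By monotonicity and `hend`, at most one of the values `0`, `π` is taken, so `g` has constant
  -- sign; its total integral being zero, every partial one vanishes.
  have hzero : ∫ r in 0..s, g r = 0 := by
    rcases hend with h0 | hπ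
    · have hneg : ∀ r ∈ Icc 0 L, g r ≤ 0 := by
        intro r h
        rcases hval r h with h1 | ⟨h1, -⟩ | ⟨-, h1⟩
        · exact h1.le
        · exact absurd (hmono m0 h h.1) (by rw [h1]; exact h0.not_ge)
        · rw [h1]; norm_num
      have i1 := intervalIntegral.integral_nonneg (f := fun r => -g r) (μ := volume) hs.1
        fun r h => neg_nonneg.mpr (hneg r ⟨h.1, h.2.trans hs.2⟩)
      have i2 := intervalIntegral.integral_nonneg (f := fun r => -g r) (μ := volume) hs.2
        fun r h => neg_nonneg.mpr (hneg r ⟨hs.1.trans h.1, h.2⟩)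
      rw [intervalIntegral.integral_neg] at i1 i2
      linarith
    · have hpos : ∀ r ∈ Icc 0 L, 0 ≤ g r := by
        intro r h
        rcases hval r h with h1 | ⟨-, h1⟩ | ⟨h1, -⟩
        · exact h1.ge
        · rw [h1]; norm_num
        · exact absurd (hmono h mL h.2) (by rw [h1]; exact hπ.not_ge)
      have i1 := intervalIntegral.integral_nonneg (f := g) (μ := volume) hs.1
        fun r h => hpos r ⟨h.1, h.2.trans hs.2⟩
      have i2 := intervalIntegral.integral_nonneg (f := g) (μ := volume) hs.2
        fun r h => hpos r ⟨hs.1.trans h.1, h.2⟩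
      linarith
  linarith

/-- Two solutions of `τ' = 2x`, `x' = cos τ` with the same initial value agree. -/
theorem eqOn_of_elastica_equation {τ₁ τ₂ x₁ x₂ : ℝ → ℝ}
    (h₁ : ∀ s ∈ Icc 0 L, HasDerivWithinAt τ₁ (2 * x₁ s) (Icc 0 L) s)
    (h₁' : ∀ s ∈ Icc 0 L, HasDerivWithinAt x₁ (Real.cos (τ₁ s)) (Icc 0 L) s)
    (h₂ : ∀ s ∈ Icc 0 L, HasDerivWithinAt τ₂ (2 * x₂ s) (Icc 0 L) s)
    (h₂' : ∀ s ∈ Icc 0 L, HasDerivWithinAt x₂ (Real.cos (τ₂ s)) (Icc 0 L) s)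
    (hτ : τ₁ 0 = τ₂ 0) (hx : x₁ 0 = x₂ 0) : EqOn τ₁ τ₂ (Icc 0 L) := by
  let v : ℝ → ℝ × ℝ → ℝ × ℝ := fun _ p => (2 * p.2, Real.cos p.1)
  have hv : ∀ t, LipschitzWith 2 (v t) := by
    intro t
    refine LipschitzWith.of_dist_le_mul fun p q => ?_
    rw [Prod.dist_eq, Prod.dist_eq]
    refine max_le ?_ ?_
    · simp only [v, Real.dist_eq, ← mul_sub, abs_mul, abs_two, NNReal.coe_ofNat]
      gcongr
      exact le_max_right _ _
    · have hcos : dist (Real.cos p.1) (Real.cos q.1) ≤ dist p.1 q.1 := by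
        simpa using Real.lipschitzWith_cos.dist_le_mul p.1 q.1
      have h := le_max_left (dist p.1 q.1) (dist p.2 q.2)
      have h0 : 0 ≤ dist p.1 q.1 := dist_nonneg
      simp only [v, NNReal.coe_ofNat]
      linarith
  have hnhds : ∀ s ∈ Ico 0 L, Icc 0 L ∈ 𝓝[Ici s] s := fun s hs =>
    Icc_mem_nhdsGE_of_mem hs
  have heq := ODE_solution_unique (v := v) (K := 2) (f := fun s => (τ₁ s, x₁ s))
    (g := fun s => (τ₂ s, x₂ s)) (a := 0) (b := L) hv
    (fun s hs => ((h₁ s hs).prodMk (h₁' s hs)).continuousWithinAt)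
    (fun s hs => ((h₁ s (Ico_subset_Icc_self hs)).prodMk
      (h₁' s (Ico_subset_Icc_self hs))).mono_of_mem_nhdsWithin (hnhds s hs))
    (fun s hs => ((h₂ s hs).prodMk (h₂' s hs)).continuousWithinAt)
    (fun s hs => ((h₂ s (Ico_subset_Icc_self hs)).prodMk
      (h₂' s (Ico_subset_Icc_self hs))).mono_of_mem_nhdsWithin (hnhds s hs))
    (Prod.ext hτ hx)
  exact fun s hs => congrArg Prod.fst (heq hs)

/-- The equation for `τ` alone lacks uniqueness where `sin τ = 0`. Adjoining `x = √(sin τ)` as a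
second unknown, which `hx₁` and `hx₂` allow, makes the system Lipschitz. -/
theorem eqOn_of_deriv_eq_two_mul_sqrt_sin {τ₁ τ₂ : ℝ → ℝ} {L₁ L₂ : ℝ}
    (h₁ : AbsolutelyContinuousOnInterval τ₁ 0 L₁) (h₂ : AbsolutelyContinuousOnInterval τ₂ 0 L₂)
    (hd₁ : ∀ᵐ s ∂volume.restrict (Icc 0 L₁), deriv τ₁ s = 2 * √(Real.sin (τ₁ s)))
    (hd₂ : ∀ᵐ s ∂volume.restrict (Icc 0 L₂), deriv τ₂ s = 2 * √(Real.sin (τ₂ s)))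
    (hx₁ : ∀ s ∈ Icc 0 L₁, √(Real.sin (τ₁ s)) = √(Real.sin (τ₁ 0)) + ∫ r in 0..s, Real.cos (τ₁ r))
    (hx₂ : ∀ s ∈ Icc 0 L₂, √(Real.sin (τ₂ s)) = √(Real.sin (τ₂ 0)) + ∫ r in 0..s, Real.cos (τ₂ r))
    (h0 : τ₁ 0 = τ₂ 0) (hL₁ : 0 ≤ L₁) (hL : L₁ ≤ L₂) : EqOn τ₁ τ₂ (Icc 0 L₁) := by
  have key : ∀ {τ : ℝ → ℝ} {L : ℝ}, 0 ≤ L → AbsolutelyContinuousOnInterval τ 0 L →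
      (∀ᵐ s ∂volume.restrict (Icc 0 L), deriv τ s = 2 * √(Real.sin (τ s))) →
      (∀ s ∈ Icc 0 L, √(Real.sin (τ s)) = √(Real.sin (τ 0)) + ∫ r in 0..s, Real.cos (τ r)) →
      ∀ s ∈ Icc 0 L, HasDerivWithinAt τ (2 * √(Real.sin (τ s))) (Icc 0 L) s ∧
        HasDerivWithinAt (fun s => √(Real.sin (τ s))) (Real.cos (τ s)) (Icc 0 L) s := by
    intro τ L hL hτ hd hx s hs
    have hc : ContinuousOn τ (Icc 0 L) := by
      have := hτ.continuousOn
      rwa [uIcc_of_le hL] at this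
    constructor
    -- Absolute continuity makes `τ` the integral of a continuous function, which upgrades the
    -- almost everywhere equation to every point.
    · have hi := (hasDerivWithinAt_integral_Icc
        ((continuous_sqrt_sin.comp_continuousOn hc).const_smul (2 : ℝ)) hs).const_add (τ 0)
      refine hi.congr_of_mem (fun t ht => ?_) hs
      have hsub : uIcc 0 t ⊆ Icc 0 L := uIcc_subset_Icc ⟨le_rfl, hL⟩ ht
      have := (hτ.mono (by rwa [uIcc_of_le hL] : uIcc 0 t ⊆ uIcc 0 L)).integral_deriv_eq_sub
      have h2 : ∫ r in 0..t, deriv τ r = ∫ r in 0..t, 2 * √(Real.sin (τ r)) := by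
        refine intervalIntegral.integral_congr_ae ?_
        filter_upwards [(ae_restrict_iff' measurableSet_Icc).mp hd] with r h3 h4
        exact h3 (hsub (uIoc_subset_uIcc h4))
      rw [h2] at this
      simp only [Pi.smul_apply, Function.comp, smul_eq_mul]
      linarith
    · exact ((hasDerivWithinAt_integral_Icc (Real.continuous_cos.comp_continuousOn hc)
        hs).const_add (√(Real.sin (τ 0)))).congr_of_mem hx hs
  have k₁ := key hL₁ h₁ hd₁ hx₁
  have k₂ := key (hL₁.trans hL) h₂ hd₂ hx₂
  have hsub : Icc 0 L₁ ⊆ Icc 0 L₂ := Icc_subset_Icc_right hL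
  exact eqOn_of_elastica_equation (fun s hs => (k₁ s hs).1) (fun s hs => (k₁ s hs).2)
    (fun s hs => (k₂ s (hsub hs)).1.mono hsub) (fun s hs => (k₂ s (hsub hs)).2.mono hsub) h0
    (by rw [h0])

end Elastica

/-! ### Direction angles of plane curves -/

/-- The difference is continuous on a connected set with values in the discrete group `2πℤ`, hence
constant. -/
theorem exists_int_eq_add_of_exp_eq {α β : ℝ → ℝ} {a b : ℝ}
    (hα : ContinuousOn α (Icc a b)) (hβ : ContinuousOn β (Icc a b))
    (h : ∀ s ∈ Icc a b, Complex.exp (α s * Complex.I) = Complex.exp (β s * Complex.I)) :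
    ∃ k : ℤ, ∀ s ∈ Icc a b, α s = β s + k * (2 * Real.pi) := by
  have hmaps : MapsTo (fun s => α s - β s) (Icc a b)
      (AddSubgroup.zmultiples (2 * Real.pi) : Set ℝ) := by
    intro s hs
    obtain ⟨n, hn⟩ := Complex.exp_eq_exp_iff_exists_int.mp (h s hs)
    refine ⟨n, ?_⟩
    have h1 : ((α s : ℝ) : ℂ) = ((β s + n * (2 * Real.pi) : ℝ) : ℂ) := by
      refine mul_right_cancel₀ Complex.I_ne_zero ?_
      rw [hn]; push_cast; ring
    have h2 : α s = β s + n * (2 * Real.pi) := Complex.ofReal_injective h1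
    simp [h2]
  have hdisc : IsDiscrete (AddSubgroup.zmultiples (2 * Real.pi) : Set ℝ) :=
    ⟨inferInstanceAs (DiscreteTopology (AddSubgroup.zmultiples (2 * Real.pi)))⟩
  obtain ⟨y, ⟨k, rfl⟩, hk⟩ := isPreconnected_Icc.eqOn_const_of_mapsTo hdisc (hα.sub hβ) hmaps
    ⟨0, zero_mem _⟩
  refine ⟨k, fun s hs => ?_⟩
  have := hk hs
  simp only [Pi.sub_apply, Function.const_apply, zsmul_eq_mul] at this
  linarith

theorem exists_int_of_exp_eq {x y : ℝ}
    (h : Complex.exp (x * Complex.I) = Complex.exp (y * Complex.I)) :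
    ∃ k : ℤ, x = y + k * (2 * Real.pi) := by
  obtain ⟨k, hk⟩ := exists_int_eq_add_of_exp_eq (α := fun _ => x) (β := fun _ => y)
    (a := 0) (b := 0) continuousOn_const continuousOn_const fun _ _ => h
  exact ⟨k, hk 0 ⟨le_rfl, le_rfl⟩⟩

namespace PlaneCurve

theorem arcParam_arcLength (f : PlaneCurve) {t : ℝ} (ht : t ∈ Icc f.a f.b) :
    f.arcParam (f.arcLength t) = t :=
  f.strictMonoOn_arcLength.injOn.leftInvOn_invFunOn ht

theorem arcParam_zero (f : PlaneCurve) : f.arcParam 0 = f.a := by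
  rw [← f.arcLength_left]
  exact f.arcParam_arcLength (left_mem_Icc.mpr f.lt.le)

theorem arcParam_length (f : PlaneCurve) : f.arcParam f.length = f.b :=
  f.arcParam_arcLength (right_mem_Icc.mpr f.lt.le)

theorem unitSpeed_vel (f : PlaneCurve) {s : ℝ} (hs : s ∈ Icc 0 f.length) :
    f.unitSpeed.vel s = f.vel (f.arcParam s) / (‖f.vel (f.arcParam s)‖ : ℂ) :=
  f.derivWithin_unitSpeed hs

theorem unitSpeed_toFun (f : PlaneCurve) (s : ℝ) :
    f.unitSpeed.toFun s = f.toFun (f.arcParam s) := rfl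

theorem initial_pos (f : PlaneCurve) : f.initial.pos = f.unitSpeed.toFun 0 := by
  rw [unitSpeed_toFun, arcParam_zero]; rfl

theorem terminal_pos (f : PlaneCurve) : f.terminal.pos = f.unitSpeed.toFun f.length := by
  rw [unitSpeed_toFun, arcParam_length]; rfl

theorem initial_dir (f : PlaneCurve) : f.initial.dir = f.unitSpeed.vel 0 := by
  rw [f.unitSpeed_vel ⟨le_rfl, f.length_pos.le⟩, arcParam_zero]; rfl

theorem terminal_dir (f : PlaneCurve) : f.terminal.dir = f.unitSpeed.vel f.length := by
  rw [f.unitSpeed_vel ⟨f.length_pos.le, le_rfl⟩, arcParam_length]; rfl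

theorem hasDerivWithinAt_unitSpeed_vel (f : PlaneCurve) {s : ℝ} (hs : s ∈ Icc 0 f.length) :
    HasDerivWithinAt f.unitSpeed.toFun (f.unitSpeed.vel s) (Icc 0 f.length) s := by
  rw [f.unitSpeed_vel hs]
  exact f.hasDerivWithinAt_unitSpeed hs

theorem isDirectionAngle_directionAngle (f : PlaneCurve) :
    f.IsDirectionAngle f.directionAngle := f.exists_isDirectionAngle.choose_spec

theorem IsDirectionAngle.continuousOn {f : PlaneCurve} {τ : ℝ → ℝ} (h : f.IsDirectionAngle τ) :
    ContinuousOn τ (Icc 0 f.length) := by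
  have := h.1.continuousOn
  rwa [uIcc_of_le f.length_pos.le] at this

theorem IsDirectionAngle.add_int {f : PlaneCurve} {τ : ℝ → ℝ} (h : f.IsDirectionAngle τ) (k : ℤ) :
    f.IsDirectionAngle (fun s => τ s + k * (2 * Real.pi)) := by
  refine ⟨absCont_of_locally_dist_le one_pos zero_le_one h.1 fun x _ y _ _ => ?_, fun s hs => ?_⟩
  · rw [dist_add_right, one_mul]
  · rw [h.2 s hs, Complex.exp_eq_exp_iff_exists_int]
    exact ⟨-k, by push_cast; ring⟩

theorem IsDirectionAngle.re_sub_eq_integral {f : PlaneCurve} {τ : ℝ → ℝ}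
    (h : f.IsDirectionAngle τ) {s : ℝ} (hs : s ∈ Icc 0 f.length) :
    (f.unitSpeed.toFun s).re - (f.unitSpeed.toFun 0).re = ∫ r in 0..s, Real.cos (τ r) := by
  have hsub : Icc 0 s ⊆ Icc 0 f.length := Icc_subset_Icc_right hs.2
  have hd : ∀ r ∈ Icc 0 f.length, HasDerivWithinAt (fun r => (f.unitSpeed.toFun r).re)
      (Real.cos (τ r)) (Icc 0 f.length) r := by
    intro r hr
    have h1 := Complex.reCLM.hasFDerivAt.comp_hasDerivWithinAt r
      (f.hasDerivWithinAt_unitSpeed_vel hr)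
    rw [h.2 r hr] at h1
    rw [Complex.reCLM_apply, Complex.exp_ofReal_mul_I_re] at h1
    exact h1
  refine (intervalIntegral.integral_eq_sub_of_hasDerivAt_of_le hs.1
    (fun r hr => (hd r (hsub hr)).continuousWithinAt.mono hsub) (fun r hr => ?_) ?_).symm
  · exact (hd r (hsub (Ioo_subset_Icc_self hr))).hasDerivAt
      (Icc_mem_nhds hr.1 (hr.2.trans_le hs.2))
  · refine ContinuousOn.intervalIntegrable ?_
    rw [uIcc_of_le hs.1]
    exact Real.continuous_cos.comp_continuousOn (h.continuousOn.mono hsub)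

theorem IsDirectionAngle.im_sub_eq_integral {f : PlaneCurve} {τ : ℝ → ℝ}
    (h : f.IsDirectionAngle τ) {s : ℝ} (hs : s ∈ Icc 0 f.length) :
    (f.unitSpeed.toFun s).im - (f.unitSpeed.toFun 0).im = ∫ r in 0..s, Real.sin (τ r) := by
  have hsub : Icc 0 s ⊆ Icc 0 f.length := Icc_subset_Icc_right hs.2
  have hd : ∀ r ∈ Icc 0 f.length, HasDerivWithinAt (fun r => (f.unitSpeed.toFun r).im)
      (Real.sin (τ r)) (Icc 0 f.length) r := by
    intro r hr
    have h1 := Complex.imCLM.hasFDerivAt.comp_hasDerivWithinAt r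
      (f.hasDerivWithinAt_unitSpeed_vel hr)
    rw [h.2 r hr] at h1
    rw [Complex.imCLM_apply, Complex.exp_ofReal_mul_I_im] at h1
    exact h1
  refine (intervalIntegral.integral_eq_sub_of_hasDerivAt_of_le hs.1
    (fun r hr => (hd r (hsub hr)).continuousWithinAt.mono hsub) (fun r hr => ?_) ?_).symm
  · exact (hd r (hsub (Ioo_subset_Icc_self hr))).hasDerivAt
      (Icc_mem_nhds hr.1 (hr.2.trans_le hs.2))
  · refine ContinuousOn.intervalIntegrable ?_
    rw [uIcc_of_le hs.1]
    exact Real.continuous_sin.comp_continuousOn (h.continuousOn.mono hsub)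

theorem turningAngle_eq (f : PlaneCurve) :
    f.turningAngle = f.directionAngle f.length - f.directionAngle 0 :=
  f.isDirectionAngle_directionAngle.1.integral_deriv_eq_sub

theorem IsLeftCurve.monotoneOn {f : PlaneCurve} (h : f.IsLeftCurve) :
    MonotoneOn f.directionAngle (Icc 0 f.length) :=
  f.isDirectionAngle_directionAngle.1.monotoneOn_of_ae_deriv_nonneg f.length_pos.le h

theorem IsRightCurve.antitoneOn {f : PlaneCurve} (h : f.IsRightCurve) :
    AntitoneOn f.directionAngle (Icc 0 f.length) :=
  f.isDirectionAngle_directionAngle.1.antitoneOn_of_ae_deriv_nonpos f.length_pos.le h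

/-- Equal unit speed curves have equal one-sided derivatives, so the angles are two lifts of the
same map. The multiple of `2π` is an artefact of choosing each angle separately. -/
theorem IsJoin.exists_directionAngle_eq_left {f₁ f₂ f : PlaneCurve} (h : IsJoin f₁ f₂ f) :
    ∃ k : ℤ, ∀ s ∈ Icc 0 f₁.length,
      f.directionAngle s = f₁.directionAngle s + k * (2 * Real.pi) := by
  obtain ⟨-, hlen, heq, -⟩ := h
  have hsub : Icc 0 f₁.length ⊆ Icc 0 f.length :=
    Icc_subset_Icc_right (by rw [hlen]; linarith [f₂.length_pos])
  refine exists_int_eq_add_of_exp_eq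
    (f.isDirectionAngle_directionAngle.continuousOn.mono hsub)
    f₁.isDirectionAngle_directionAngle.continuousOn fun s hs => ?_
  rw [← f.isDirectionAngle_directionAngle.2 s (hsub hs),
    ← f₁.isDirectionAngle_directionAngle.2 s hs]
  have h1 := ((f.hasDerivWithinAt_unitSpeed_vel (hsub hs)).mono hsub).congr_of_mem
    (fun r hr => (heq r hr).symm) hs
  exact (uniqueDiffOn_Icc f₁.length_pos s hs).eq_deriv _ h1 (f₁.hasDerivWithinAt_unitSpeed_vel hs)

theorem IsJoin.exists_directionAngle_eq_right {f₁ f₂ f : PlaneCurve} (h : IsJoin f₁ f₂ f) :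
    ∃ k : ℤ, ∀ s ∈ Icc 0 f₂.length,
      f.directionAngle (f₁.length + s) = f₂.directionAngle s + k * (2 * Real.pi) := by
  obtain ⟨-, hlen, -, heq⟩ := h
  have hmaps : MapsTo (fun s => f₁.length + s) (Icc 0 f₂.length) (Icc 0 f.length) :=
    fun s hs => ⟨by linarith [f₁.length_pos, hs.1], by linarith [hs.2]⟩
  refine exists_int_eq_add_of_exp_eq
    (f.isDirectionAngle_directionAngle.continuousOn.comp (by fun_prop) hmaps)
    f₂.isDirectionAngle_directionAngle.continuousOn fun s hs => ?_
  rw [← f.isDirectionAngle_directionAngle.2 _ (hmaps hs),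
    ← f₂.isDirectionAngle_directionAngle.2 s hs]
  have h1 := ((f.hasDerivWithinAt_unitSpeed_vel (hmaps hs)).scomp s
    ((hasDerivWithinAt_id s _).const_add f₁.length) hmaps).congr_of_mem
    (fun r hr => (heq r hr).symm) hs
  rw [one_smul] at h1
  exact (uniqueDiffOn_Icc f₂.length_pos s hs).eq_deriv _ h1 (f₂.hasDerivWithinAt_unitSpeed_vel hs)

/-- Puts all kinds of s-curve into one form. A single c-curve is given its turning point at the
terminal end, where the second arc degenerates to a point. -/
theorem IsSCurve.exists_turn {f : PlaneCurve} (h : f.IsSCurve) : ∃ c ∈ Icc 0 f.length,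
    (MonotoneOn f.directionAngle (Icc 0 c) ∧ AntitoneOn f.directionAngle (Icc c f.length) ∧
      f.directionAngle c - f.directionAngle 0 ≤ Real.pi ∧
      f.directionAngle c - f.directionAngle f.length ≤ Real.pi) ∨
    (AntitoneOn f.directionAngle (Icc 0 c) ∧ MonotoneOn f.directionAngle (Icc c f.length) ∧
      f.directionAngle 0 - f.directionAngle c ≤ Real.pi ∧
      f.directionAngle f.length - f.directionAngle c ≤ Real.pi) := by
  have hpi := Real.pi_pos
  rcases h with (⟨h1, h2⟩ | ⟨h1, h2⟩) | ⟨f₁, f₂, hj, hturn⟩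
  · rw [turningAngle_eq] at h2
    refine ⟨f.length, ⟨f.length_pos.le, le_rfl⟩, Or.inl ⟨h1.monotoneOn, ?_, (abs_le.mp h2).2, ?_⟩⟩
    · rw [Icc_self]; exact subsingleton_singleton.antitoneOn _
    · rw [sub_self]; exact hpi.le
  · rw [turningAngle_eq] at h2
    refine ⟨f.length, ⟨f.length_pos.le, le_rfl⟩, Or.inr ⟨h1.antitoneOn, ?_, ?_, ?_⟩⟩
    · rw [Icc_self]; exact subsingleton_singleton.monotoneOn _
    · linarith [(abs_le.mp h2).1]
    · rw [sub_self]; exact hpi.le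
  · obtain ⟨k₁, e₁⟩ := hj.exists_directionAngle_eq_left
    obtain ⟨k₂, e₂⟩ := hj.exists_directionAngle_eq_right
    have hlen := hj.2.1
    have p₁ := f₁.length_pos
    have p₂ := f₂.length_pos
    have e₂' : ∀ s ∈ Icc f₁.length f.length,
        f.directionAngle s = f₂.directionAngle (s - f₁.length) + k₂ * (2 * Real.pi) := by
      intro s hs
      rw [← e₂ _ ⟨by linarith [hs.1], by linarith [hs.2]⟩, add_sub_cancel]
    have hm₂ : ∀ s ∈ Icc f₁.length f.length, s - f₁.length ∈ Icc 0 f₂.length :=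
      fun s hs => ⟨by linarith [hs.1], by linarith [hs.2]⟩
    have a₀ := e₁ 0 ⟨le_rfl, p₁.le⟩
    have a₁ := e₁ f₁.length ⟨p₁.le, le_rfl⟩
    have a₂ := e₂' f₁.length ⟨le_rfl, by linarith⟩
    have a₃ := e₂' f.length ⟨by linarith, le_rfl⟩
    rw [sub_self] at a₂
    rw [hlen, add_sub_cancel_left, ← hlen] at a₃
    refine ⟨f₁.length, ⟨p₁.le, by linarith⟩, ?_⟩
    rcases hturn with ⟨⟨l₁, t₁⟩, ⟨r₂, t₂⟩⟩ | ⟨⟨r₁, t₁⟩, ⟨l₂, t₂⟩⟩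
    · left
      rw [turningAngle_eq, abs_le] at t₁ t₂
      refine ⟨fun x hx y hy hxy => ?_, fun x hx y hy hxy => ?_, ?_, ?_⟩
      · rw [e₁ x hx, e₁ y hy]
        linarith [l₁.monotoneOn hx hy hxy]
      · rw [e₂' x hx, e₂' y hy]
        linarith [r₂.antitoneOn (hm₂ x hx) (hm₂ y hy) (by linarith)]
      · linarith [t₁.2]
      · linarith [t₂.1]
    · right
      rw [turningAngle_eq, abs_le] at t₁ t₂
      refine ⟨fun x hx y hy hxy => ?_, fun x hx y hy hxy => ?_, ?_, ?_⟩
      · rw [e₁ x hx, e₁ y hy]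
        linarith [r₁.antitoneOn hx hy hxy]
      · rw [e₂' x hx, e₂' y hy]
        linarith [l₂.monotoneOn (hm₂ x hx) (hm₂ y hy) (by linarith)]
      · linarith [t₁.1]
      · linarith [t₂.2]

theorem bendingEnergy_eq {f : PlaneCurve} {τ : ℝ → ℝ}
    (h : ∀ s, deriv τ s = f.signedCurvature s) :
    f.bendingEnergy = ∫⁻ s in Icc 0 f.length, ENNReal.ofReal (deriv τ s ^ 2 / 4) := by
  rw [bendingEnergy, one_div_four_mul_lintegral_sq]
  simp only [h]

end PlaneCurve

/-! ### From s-curves with prescribed end tangents to admissible angles. -/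

section Connecting

variable {θ₁ θ₂ : ℝ} {u v : UnitTangentVector}

/-- The lift is normalised at the initial point. At the terminal point it is then known only modulo
`2π`, and the bounds on turning pin it down. -/
theorem exists_isAdmissibleAngle (h₁₂ : θ₁ < θ₂) (h₂ : θ₂ - θ₁ < Real.pi)
    (hu : u.dir = Complex.exp (θ₁ * Complex.I)) (hv : v.dir = Complex.exp (θ₂ * Complex.I))
    (hre : v.pos.re - u.pos.re = √(Real.sin θ₂) - √(Real.sin θ₁))
    (him : v.pos.im - u.pos.im = (sqrtSinPrimitive θ₂ - sqrtSinPrimitive θ₁) / 2)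
    {f : PlaneCurve} (hf : f ∈ sCurves u v) :
    ∃ τ : ℝ → ℝ, f.IsDirectionAngle τ ∧ (∀ s, deriv τ s = f.signedCurvature s) ∧
      IsAdmissibleAngle θ₁ θ₂ f.length τ := by
  obtain ⟨hs, hc1, hc2⟩ := hf
  have hpi := Real.pi_pos
  have m0 : (0 : ℝ) ∈ Icc 0 f.length := ⟨le_rfl, f.length_pos.le⟩
  have mL : f.length ∈ Icc 0 f.length := ⟨f.length_pos.le, le_rfl⟩
  have hτ := f.isDirectionAngle_directionAngle
  obtain ⟨k, hk⟩ : ∃ k : ℤ, θ₁ = f.directionAngle 0 + k * (2 * Real.pi) := by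
    refine exists_int_of_exp_eq ?_
    rw [← hτ.2 0 m0, ← hu, ← hc1, f.initial_dir]
  obtain ⟨j, hj⟩ : ∃ j : ℤ, f.directionAngle f.length + k * (2 * Real.pi) =
      θ₂ + j * (2 * Real.pi) := by
    refine exists_int_of_exp_eq ?_
    rw [← hv, ← hc2, f.terminal_dir, (hτ.add_int k).2 _ mL]
  obtain ⟨c, hc, hturn⟩ := hs.exists_turn
  have n0 : (0 : ℝ) ∈ Icc 0 c := ⟨le_rfl, hc.1⟩
  have nc : c ∈ Icc 0 c := ⟨hc.1, le_rfl⟩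
  have nc' : c ∈ Icc c f.length := ⟨le_rfl, hc.2⟩
  have nL : f.length ∈ Icc c f.length := ⟨hc.2, le_rfl⟩
  -- The total turning is `θ₂ - θ₁ + 2πj` and has magnitude at most `π`, while `0 < θ₂ - θ₁ < π`.
  have hj0 : j = 0 := by
    have hb : -Real.pi ≤ f.directionAngle f.length - f.directionAngle 0 ∧
        f.directionAngle f.length - f.directionAngle 0 ≤ Real.pi := by
      rcases hturn with ⟨hm, ha, b1, b2⟩ | ⟨ha, hm, b1, b2⟩
      · exact ⟨by linarith [hm n0 nc hc.1], by linarith [ha nc' nL hc.2]⟩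
      · exact ⟨by linarith [hm nc' nL hc.2], by linarith [ha n0 nc hc.1]⟩
    have j1 : j < 1 := by
      by_contra! hge
      have : (1 : ℝ) ≤ j := by exact_mod_cast hge
      nlinarith [hb.2]
    have j2 : -1 < j := by
      by_contra! hle
      have : (j : ℝ) ≤ -1 := by exact_mod_cast hle
      nlinarith [hb.1]
    omega
  rw [hj0, Int.cast_zero, zero_mul, add_zero] at hj
  have hτk := hτ.add_int k
  refine ⟨_, hτk, fun s => deriv_add_const _, f.length_pos.le, hτk.1, hk.symm, hj, ?_, ?_, c, hc,
    ?_⟩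
  · rw [← him, ← hc1, ← hc2, f.initial_pos, f.terminal_pos, hτk.im_sub_eq_integral mL]
  · rw [← hre, ← hc1, ← hc2, f.initial_pos, f.terminal_pos, hτk.re_sub_eq_integral mL]
  · rcases hturn with ⟨hm, ha, b1, b2⟩ | ⟨ha, hm, b1, b2⟩
    · exact Or.inl ⟨hm.add_const _, ha.add_const _, by linarith⟩
    · exact Or.inr ⟨ha.add_const _, hm.add_const _, by linarith⟩

theorem le_bendingEnergy_of_mem_sCurves (h₁ : 0 ≤ θ₁) (h₁₂ : θ₁ < θ₂) (hπ : θ₂ ≤ Real.pi)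
    (h₂ : θ₂ - θ₁ < Real.pi)
    (hu : u.dir = Complex.exp (θ₁ * Complex.I)) (hv : v.dir = Complex.exp (θ₂ * Complex.I))
    (hre : v.pos.re - u.pos.re = √(Real.sin θ₂) - √(Real.sin θ₁))
    (him : v.pos.im - u.pos.im = (sqrtSinPrimitive θ₂ - sqrtSinPrimitive θ₁) / 2)
    {f : PlaneCurve} (hf : f ∈ sCurves u v) :
    ENNReal.ofReal ((sqrtSinPrimitive θ₂ - sqrtSinPrimitive θ₁) / 2) ≤ f.bendingEnergy := by
  obtain ⟨τ, -, hd, hτ⟩ := exists_isAdmissibleAngle h₁₂ h₂ hu hv hre him hf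
  rw [PlaneCurve.bendingEnergy_eq hd]
  exact hτ.le_energy h₁ h₁₂ hπ

/-- Two s-curves whose bending energy attains the lower bound are equivalent. -/
theorem equivalent_of_bendingEnergy_le (h₁ : 0 ≤ θ₁) (h₁₂ : θ₁ < θ₂) (hπ : θ₂ ≤ Real.pi)
    (h₂ : θ₂ - θ₁ < Real.pi)
    (hu : u.dir = Complex.exp (θ₁ * Complex.I)) (hv : v.dir = Complex.exp (θ₂ * Complex.I))
    (hre : v.pos.re - u.pos.re = √(Real.sin θ₂) - √(Real.sin θ₁))
    (him : v.pos.im - u.pos.im = (sqrtSinPrimitive θ₂ - sqrtSinPrimitive θ₁) / 2)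
    {f g : PlaneCurve} (hf : f ∈ sCurves u v) (hg : g ∈ sCurves u v)
    (hfE : f.bendingEnergy ≤ ENNReal.ofReal ((sqrtSinPrimitive θ₂ - sqrtSinPrimitive θ₁) / 2))
    (hgE : g.bendingEnergy ≤ ENNReal.ofReal ((sqrtSinPrimitive θ₂ - sqrtSinPrimitive θ₁) / 2)) :
    f.Equivalent g := by
  wlog hL : f.length ≤ g.length generalizing f g
  · obtain ⟨e, he⟩ := this hg hf hgE hfE (le_of_not_ge hL)
    exact ⟨e.symm, e ▸ he.symm⟩
  obtain ⟨τ, haτ, hdτ, hτ⟩ := exists_isAdmissibleAngle h₁₂ h₂ hu hv hre him hf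
  obtain ⟨ρ, haρ, hdρ, hρ⟩ := exists_isAdmissibleAngle h₁₂ h₂ hu hv hre him hg
  rw [PlaneCurve.bendingEnergy_eq hdτ] at hfE
  rw [PlaneCurve.bendingEnergy_eq hdρ] at hgE
  obtain ⟨rτ, cτ⟩ := hτ.deriv_eq_of_energy_le h₁ h₁₂ hπ hfE
  obtain ⟨rρ, cρ⟩ := hρ.deriv_eq_of_energy_le h₁ h₁₂ hπ hgE
  -- An arc from `0` to `π` would touch both degenerate angles; `θ₂ - θ₁ < π` excludes it.
  have hend : 0 < θ₁ ∨ θ₂ < Real.pi := by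
    rcases h₁.eq_or_lt with h | h
    · right; linarith
    · exact Or.inl h
  have hxτ := fun s hs => sqrt_sin_eq_add_integral_cos (s := s) hτ.absCont hτ.length_nonneg rτ cτ
    (by rwa [hτ.left, hτ.right]) (by rw [hτ.left, hτ.right, hτ.integral_cos]) hs
  have hxρ := fun s hs => sqrt_sin_eq_add_integral_cos (s := s) hρ.absCont hρ.length_nonneg rρ cρ
    (by rwa [hρ.left, hρ.right]) (by rw [hρ.left, hρ.right, hρ.integral_cos]) hs
  have heq := eqOn_of_deriv_eq_two_mul_sqrt_sin hτ.absCont hρ.absCont cτ cρ hxτ hxρ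
    (by rw [hτ.left, hρ.left]) hτ.length_nonneg hL
  have hsub : Icc 0 f.length ⊆ Icc 0 g.length := Icc_subset_Icc_right hL
  have mf : f.length ∈ Icc 0 f.length := ⟨hτ.length_nonneg, le_rfl⟩
  have mg : g.length ∈ Icc 0 g.length := ⟨hρ.length_nonneg, le_rfl⟩
  have h0 : f.unitSpeed.toFun 0 = g.unitSpeed.toFun 0 := by
    rw [← f.initial_pos, ← g.initial_pos, hf.2.1, hg.2.1]
  have hF : EqOn f.unitSpeed.toFun g.unitSpeed.toFun (Icc 0 f.length) := by
    intro s hs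
    have hcongr : ∀ r ∈ uIcc 0 s, τ r = ρ r := fun r hr =>
      heq (uIcc_subset_Icc ⟨le_rfl, hτ.length_nonneg⟩ hs hr)
    have a1 := haτ.re_sub_eq_integral hs
    have a2 := haρ.re_sub_eq_integral (hsub hs)
    have a3 := haτ.im_sub_eq_integral hs
    have a4 := haρ.im_sub_eq_integral (hsub hs)
    rw [intervalIntegral.integral_congr fun r hr => congrArg Real.cos (hcongr r hr), ← a2, h0] at a1
    rw [intervalIntegral.integral_congr fun r hr => congrArg Real.sin (hcongr r hr), ← a4, h0] at a3
    exact Complex.ext (by linarith) (by linarith)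
  refine ⟨?_, hF⟩
  have hmono : MonotoneOn ρ (Icc 0 g.length) :=
    hρ.absCont.monotoneOn_of_ae_deriv_nonneg hρ.length_nonneg (by
      filter_upwards [cρ] with r h
      rw [h]; positivity)
  -- Where `f` ends, `ρ` has already reached its final value, and it is monotone: the rest of `g` is
  -- a straight segment.
  have hconst : ∀ r ∈ uIcc f.length g.length, ρ r = θ₂ := by
    intro r hr
    rw [uIcc_of_le hL] at hr
    have b1 := hmono (hsub mf) ⟨mf.1.trans hr.1, hr.2⟩ hr.1
    have b2 := hmono ⟨mf.1.trans hr.1, hr.2⟩ mg hr.2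
    rw [← heq mf, hτ.right] at b1
    rw [hρ.right] at b2
    exact le_antisymm b2 b1
  have hpos : g.unitSpeed.toFun f.length = g.unitSpeed.toFun g.length := by
    rw [← hF mf, ← f.terminal_pos, ← g.terminal_pos, hf.2.2, hg.2.2]
  have hcont := haρ.continuousOn
  have i1 : IntervalIntegrable (fun r => Real.cos (ρ r)) volume 0 f.length := by
    refine ContinuousOn.intervalIntegrable ?_
    rw [uIcc_of_le mf.1]
    exact Real.continuous_cos.comp_continuousOn (hcont.mono hsub)
  have i2 : IntervalIntegrable (fun r => Real.cos (ρ r)) volume 0 g.length := by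
    refine ContinuousOn.intervalIntegrable ?_
    rw [uIcc_of_le mg.1]
    exact Real.continuous_cos.comp_continuousOn hcont
  have i3 : IntervalIntegrable (fun r => Real.sin (ρ r)) volume 0 f.length := by
    refine ContinuousOn.intervalIntegrable ?_
    rw [uIcc_of_le mf.1]
    exact Real.continuous_sin.comp_continuousOn (hcont.mono hsub)
  have i4 : IntervalIntegrable (fun r => Real.sin (ρ r)) volume 0 g.length := by
    refine ContinuousOn.intervalIntegrable ?_
    rw [uIcc_of_le mg.1]
    exact Real.continuous_sin.comp_continuousOn hcont
  have c1 := intervalIntegral.integral_interval_sub_left i2 i1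
  have c2 := intervalIntegral.integral_interval_sub_left i4 i3
  rw [← haρ.re_sub_eq_integral mg, ← haρ.re_sub_eq_integral (hsub mf), hpos, sub_self,
    intervalIntegral.integral_congr fun r hr => congrArg Real.cos (hconst r hr),
    intervalIntegral.integral_const, smul_eq_mul] at c1
  rw [← haρ.im_sub_eq_integral mg, ← haρ.im_sub_eq_integral (hsub mf), hpos, sub_self,
    intervalIntegral.integral_congr fun r hr => congrArg Real.sin (hconst r hr),
    intervalIntegral.integral_const, smul_eq_mul] at c2
  -- The straight remainder has displacement zero in both coordinates; `cos² + sin² = 1` turns this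
  -- into zero length.
  have hz : (g.length - f.length) ^ 2 = 0 := by
    linear_combination (-(g.length - f.length) * Real.cos θ₂) * c1 -
      (g.length - f.length) * Real.sin θ₂ * c2 -
      (g.length - f.length) ^ 2 * Real.sin_sq_add_cos_sq θ₂
  have := pow_eq_zero_iff (two_ne_zero) |>.mp hz
  linarith

end Connecting

/-! ### The direction angle of the rectangular elastica -/

/-- The direction angle of `E` at the parameter `t`. -/
noncomputable def elasticaAngle (t : ℝ) : ℝ :=
  ∫ r in 0..t, 2 * Real.sin r / √(1 + Real.sin r ^ 2)

theorem sqrt_one_add_sin_sq_pos (t : ℝ) : 0 < √(1 + Real.sin t ^ 2) :=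
  Real.sqrt_pos.mpr (by positivity)

theorem sq_sqrt_one_add_sin_sq (t : ℝ) : √(1 + Real.sin t ^ 2) ^ 2 = 1 + Real.sin t ^ 2 :=
  Real.sq_sqrt (by positivity)

theorem hasDerivAt_elasticaAngle (t : ℝ) :
    HasDerivAt elasticaAngle (2 * Real.sin t / √(1 + Real.sin t ^ 2)) t := by
  have hc : Continuous fun r : ℝ => 2 * Real.sin r / √(1 + Real.sin r ^ 2) :=
    Continuous.div (by fun_prop) (by fun_prop) fun r => (sqrt_one_add_sin_sq_pos r).ne'
  exact intervalIntegral.integral_hasDerivAt_right (hc.intervalIntegrable _ _)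
    (hc.stronglyMeasurableAtFilter _ _) hc.continuousAt

theorem continuous_elasticaAngle : Continuous elasticaAngle :=
  continuous_iff_continuousAt.mpr fun t => (hasDerivAt_elasticaAngle t).continuousAt

theorem elasticaAngle_zero : elasticaAngle 0 = 0 := by simp [elasticaAngle]

theorem lipschitzWith_elasticaAngle : LipschitzWith 2 elasticaAngle := by
  refine lipschitzWith_of_nnnorm_deriv_le (fun t => (hasDerivAt_elasticaAngle t).differentiableAt)
    fun t => ?_
  rw [(hasDerivAt_elasticaAngle t).deriv, ← NNReal.coe_le_coe, coe_nnnorm, Real.norm_eq_abs,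
    abs_div, abs_mul, abs_two, abs_of_pos (sqrt_one_add_sin_sq_pos t), NNReal.coe_ofNat]
  have h1 : 1 ≤ √(1 + Real.sin t ^ 2) := Real.one_le_sqrt.mpr (by nlinarith [sq_nonneg (Real.sin t)])
  rw [div_le_iff₀ (sqrt_one_add_sin_sq_pos t)]
  have := Real.abs_sin_le_one t
  linarith

theorem hasDerivAt_cos_mul_sqrt (t : ℝ) :
    HasDerivAt (fun t => Real.cos t * √(1 + Real.sin t ^ 2))
      (-(Real.sin t ^ 2 * (2 * Real.sin t / √(1 + Real.sin t ^ 2)))) t := by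
  have h1 := (((Real.hasDerivAt_sin t).pow 2).const_add 1).sqrt
    (by positivity : 1 + Real.sin t ^ 2 ≠ 0)
  refine ((Real.hasDerivAt_cos t).mul h1).congr_deriv ?_
  have h2 := (sqrt_one_add_sin_sq_pos t).ne'
  have h3 := sq_sqrt_one_add_sin_sq t
  have h4 := Real.sin_sq_add_cos_sq t
  simp only [Pi.pow_apply]
  field_simp
  norm_num
  rw [h3]
  linear_combination (2 * Real.sin t) * h4

/-- Both plane vectors start at `(1, 0)` and rotate with the same angular velocity, so their scalar
and cross products are constant, equal to `1` and `0`. -/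
theorem cos_sin_elasticaAngle (t : ℝ) :
    Real.cos (elasticaAngle t) = Real.cos t * √(1 + Real.sin t ^ 2) ∧
      Real.sin (elasticaAngle t) = Real.sin t ^ 2 := by
  set c : ℝ → ℝ := fun t => Real.cos t * √(1 + Real.sin t ^ 2) with hc
  set s : ℝ → ℝ := fun t => Real.sin t ^ 2 with hs
  have dc := hasDerivAt_cos_mul_sqrt
  have ds : ∀ t, HasDerivAt s (c t * (2 * Real.sin t / √(1 + Real.sin t ^ 2))) t := by
    intro t
    refine ((Real.hasDerivAt_sin t).pow 2).congr_deriv ?_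
    have h2 := (sqrt_one_add_sin_sq_pos t).ne'
    simp only [hc]
    field_simp
    ring
  have dcos : ∀ t, HasDerivAt (fun t => Real.cos (elasticaAngle t))
      (-Real.sin (elasticaAngle t) * (2 * Real.sin t / √(1 + Real.sin t ^ 2))) t :=
    fun t => (hasDerivAt_elasticaAngle t).cos
  have dsin : ∀ t, HasDerivAt (fun t => Real.sin (elasticaAngle t))
      (Real.cos (elasticaAngle t) * (2 * Real.sin t / √(1 + Real.sin t ^ 2))) t :=
    fun t => (hasDerivAt_elasticaAngle t).sin
  have dA : ∀ t, HasDerivAt (fun t => Real.cos (elasticaAngle t) * c t +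
      Real.sin (elasticaAngle t) * s t) 0 t := fun t =>
    (((dcos t).mul (dc t)).add ((dsin t).mul (ds t))).congr_deriv (by simp only [hc, hs]; ring)
  have dB : ∀ t, HasDerivAt (fun t => Real.sin (elasticaAngle t) * c t -
      Real.cos (elasticaAngle t) * s t) 0 t := fun t =>
    (((dsin t).mul (dc t)).sub ((dcos t).mul (ds t))).congr_deriv (by simp only [hc, hs]; ring)
  have hA := is_const_of_deriv_eq_zero (fun t => (dA t).differentiableAt)
    (fun t => (dA t).deriv) t 0
  have hB := is_const_of_deriv_eq_zero (fun t => (dB t).differentiableAt)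
    (fun t => (dB t).deriv) t 0
  simp only [elasticaAngle_zero, Real.cos_zero, Real.sin_zero, hc, hs] at hA hB
  norm_num at hA hB
  have h4 := Real.sin_sq_add_cos_sq (elasticaAngle t)
  constructor
  · linear_combination (-Real.cos (elasticaAngle t)) * hA - Real.sin (elasticaAngle t) * hB +
      Real.cos t * √(1 + Real.sin t ^ 2) * h4
  · linear_combination (-Real.sin (elasticaAngle t)) * hA + Real.cos (elasticaAngle t) * hB +
      Real.sin t ^ 2 * h4

theorem strictMonoOn_elasticaAngle : StrictMonoOn elasticaAngle (Icc 0 Real.pi) := by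
  refine strictMonoOn_of_deriv_pos (convex_Icc _ _) continuous_elasticaAngle.continuousOn
    fun t ht => ?_
  rw [interior_Icc] at ht
  rw [(hasDerivAt_elasticaAngle t).deriv]
  exact div_pos (mul_pos two_pos (Real.sin_pos_of_mem_Ioo ht)) (sqrt_one_add_sin_sq_pos t)

/-- The angle cannot take the value `π` earlier, because its sine is `sin² t > 0` inside the
interval. No evaluation of the defining integral is needed. -/
theorem elasticaAngle_lt_pi {t : ℝ} (h0 : 0 ≤ t) (ht : t < Real.pi) :
    elasticaAngle t < Real.pi := by
  by_contra! hge
  obtain ⟨r, hr, hrπ⟩ := intermediate_value_Icc h0 continuous_elasticaAngle.continuousOn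
    (⟨by rw [elasticaAngle_zero]; exact Real.pi_pos.le, hge⟩ :
      Real.pi ∈ Icc (elasticaAngle 0) (elasticaAngle t))
  have h1 := (cos_sin_elasticaAngle r).2
  rw [hrπ, Real.sin_pi] at h1
  rcases hr.1.eq_or_lt with h2 | h2
  · rw [← h2, elasticaAngle_zero] at hrπ
    exact Real.pi_pos.ne hrπ
  · have := Real.sin_pos_of_pos_of_lt_pi h2 (hr.2.trans_lt ht)
    have : 0 < Real.sin r ^ 2 := by positivity
    linarith

theorem elasticaAngle_mem_Icc {t : ℝ} (ht : t ∈ Icc 0 Real.pi) :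
    elasticaAngle t ∈ Icc 0 Real.pi := by
  have hpi := Real.pi_pos
  refine ⟨?_, ?_⟩
  · rw [← elasticaAngle_zero]
    exact strictMonoOn_elasticaAngle.monotoneOn ⟨le_rfl, hpi.le⟩ ht ht.1
  · by_contra! hgt
    obtain ⟨r, hr, hrπ⟩ := intermediate_value_Icc ht.1 continuous_elasticaAngle.continuousOn
      (⟨by rw [elasticaAngle_zero]; exact hpi.le, hgt.le⟩ :
        Real.pi ∈ Icc (elasticaAngle 0) (elasticaAngle t))
    have hrt : r < t := lt_of_le_of_ne hr.2 fun h => by rw [← h, hrπ] at hgt; exact hgt.false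
    exact (elasticaAngle_lt_pi hr.1 (hrt.trans_le ht.2)).ne hrπ

theorem elasticaAngle_sub_lt_pi {t₁ t₂ : ℝ} (h₀ : 0 ≤ t₁) (h₁₂ : t₁ < t₂) (h₂ : t₂ ≤ Real.pi)
    (hlt : t₂ - t₁ < Real.pi) : elasticaAngle t₂ - elasticaAngle t₁ < Real.pi := by
  have hpi := Real.pi_pos
  have b₂ := elasticaAngle_mem_Icc ⟨h₀.trans h₁₂.le, h₂⟩
  rcases h₀.eq_or_lt with h | h
  · rw [← h, elasticaAngle_zero, sub_zero]
    exact elasticaAngle_lt_pi (h₀.trans h₁₂.le) (by linarith)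
  · have := strictMonoOn_elasticaAngle ⟨le_rfl, hpi.le⟩ ⟨h₀, h₁₂.le.trans h₂⟩ h
    rw [elasticaAngle_zero] at this
    linarith [b₂.2]

theorem sqrt_sin_elasticaAngle {t : ℝ} (ht : t ∈ Icc 0 Real.pi) :
    √(Real.sin (elasticaAngle t)) = Real.sin t := by
  rw [(cos_sin_elasticaAngle t).2, Real.sqrt_sq (Real.sin_nonneg_of_mem_Icc ht)]

/-- On `[0, π]`, `√(sin φ) φ' = 2 ξ'` for the angle `φ`, because `√(sin φ) = sin t`. -/
theorem elasticaXi_eq {t : ℝ} (ht : t ∈ Icc 0 Real.pi) :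
    elasticaXi t = sqrtSinPrimitive (elasticaAngle t) / 2 := by
  have hd : ∀ r, HasDerivAt (fun r => sqrtSinPrimitive (elasticaAngle r) - 2 * elasticaXi r)
      (√(Real.sin (elasticaAngle r)) * (2 * Real.sin r / √(1 + Real.sin r ^ 2)) -
        2 * (Real.sin r ^ 2 / √(1 + Real.sin r ^ 2))) r := fun r =>
    ((hasDerivAt_sqrtSinPrimitive _).comp r (hasDerivAt_elasticaAngle r)).sub
      ((hasDerivAt_elasticaXi r).const_mul 2)
  have hconst := constant_of_has_deriv_right_zero (a := 0) (b := Real.pi)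
    (fun r _ => (hd r).continuousAt.continuousWithinAt) (fun r hr => by
      refine (hd r).hasDerivWithinAt.congr_deriv ?_
      rw [sqrt_sin_elasticaAngle (Ico_subset_Icc_self hr)]
      ring) t ht
  have hxi : elasticaXi 0 = 0 := by simp [elasticaXi]
  simp only [elasticaAngle_zero, sqrtSinPrimitive_zero, hxi] at hconst
  linarith

theorem deriv_elastica_eq (t : ℝ) : deriv elastica t =
    ((√(1 + Real.sin t ^ 2))⁻¹ : ℝ) * Complex.exp (elasticaAngle t * Complex.I) := by
  rw [(hasDerivAt_elastica t).deriv, Complex.exp_mul_I, ← Complex.ofReal_cos,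
    ← Complex.ofReal_sin, (cos_sin_elasticaAngle t).1, (cos_sin_elasticaAngle t).2]
  have h := (sqrt_one_add_sin_sq_pos t).ne'
  have h' : ((√(1 + Real.sin t ^ 2) : ℝ) : ℂ) ≠ 0 := by exact_mod_cast h
  push_cast at h' ⊢
  field_simp

theorem norm_deriv_elastica (t : ℝ) : ‖deriv elastica t‖ = (√(1 + Real.sin t ^ 2))⁻¹ := by
  rw [deriv_elastica_eq, norm_mul, Complex.norm_exp_ofReal_mul_I, mul_one, Complex.norm_real,
    Real.norm_of_nonneg (by positivity)]

theorem deriv_elastica_div_norm (t : ℝ) :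
    deriv elastica t / (‖deriv elastica t‖ : ℂ) = Complex.exp (elasticaAngle t * Complex.I) := by
  have h : (((√(1 + Real.sin t ^ 2))⁻¹ : ℝ) : ℂ) ≠ 0 := by
    exact_mod_cast (inv_pos.mpr (sqrt_one_add_sin_sq_pos t)).ne'
  rw [norm_deriv_elastica, deriv_elastica_eq, mul_div_cancel_left₀ _ h]

/-! ### Curvature and turning angle computed from any direction angle. -/

namespace PlaneCurve

theorem hasDerivAt_arcParam (f : PlaneCurve) {s : ℝ} (hs : s ∈ Ioo 0 f.length) :
    HasDerivAt f.arcParam ‖f.vel (f.arcParam s)‖⁻¹ s := by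
  have hs' := Ioo_subset_Icc_self hs
  have hp := f.arcParam_mem hs'
  have hnhds : Icc 0 f.length ∈ 𝓝 s := Icc_mem_nhds hs.1 hs.2
  obtain ⟨K, hK⟩ := f.exists_lipschitz_arcParam
  have hlt : f.arcParam s ∈ Ioo f.a f.b := by
    refine ⟨lt_of_le_of_ne hp.1 fun h => ?_, lt_of_le_of_ne hp.2 fun h => ?_⟩
    · have := f.arcLength_arcParam hs'
      rw [← h, f.arcLength_left] at this
      exact hs.1.ne this
    · have := f.arcLength_arcParam hs'
      rw [h] at this
      exact hs.2.ne this.symm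
  exact HasDerivAt.of_local_left_inverse (hK.continuousOn.continuousAt hnhds)
    ((f.hasDerivWithinAt_arcLength hp).hasDerivAt (Icc_mem_nhds hlt.1 hlt.2))
    (norm_ne_zero_iff.mpr (f.ne_zero _ hp))
    (Filter.eventually_of_mem hnhds fun x hx => f.arcLength_arcParam hx)

/-- Only interior points are allowed: at an end point `deriv` also sees the irrelevant values
outside the interval. -/
theorem IsDirectionAngle.signedCurvature_eq {f : PlaneCurve} {τ : ℝ → ℝ}
    (h : f.IsDirectionAngle τ) {s : ℝ} (hs : s ∈ Ioo 0 f.length) :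
    f.signedCurvature s = deriv τ s := by
  obtain ⟨k, hk⟩ := exists_int_eq_add_of_exp_eq f.isDirectionAngle_directionAngle.continuousOn
    h.continuousOn fun r hr => by rw [← f.isDirectionAngle_directionAngle.2 r hr, ← h.2 r hr]
  have he : f.directionAngle =ᶠ[𝓝 s] fun r => τ r + k * (2 * Real.pi) :=
    Filter.eventually_of_mem (Icc_mem_nhds hs.1 hs.2) hk
  rw [signedCurvature, he.deriv_eq, deriv_add_const]

theorem IsDirectionAngle.turningAngle_eq {f : PlaneCurve} {τ : ℝ → ℝ}
    (h : f.IsDirectionAngle τ) : f.turningAngle = τ f.length - τ 0 := by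
  obtain ⟨k, hk⟩ := exists_int_eq_add_of_exp_eq f.isDirectionAngle_directionAngle.continuousOn
    h.continuousOn fun r hr => by rw [← f.isDirectionAngle_directionAngle.2 r hr, ← h.2 r hr]
  rw [PlaneCurve.turningAngle_eq, hk _ ⟨f.length_pos.le, le_rfl⟩, hk _ ⟨le_rfl, f.length_pos.le⟩]
  ring

end PlaneCurve

/-! ### Segments of the rectangular elastica -/

section Segment

variable {t₁ t₂ : ℝ}

theorem elasticaSegment_vel (h₁₂ : t₁ < t₂) {t : ℝ} (ht : t ∈ Icc t₁ t₂) :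
    (elasticaSegment t₁ t₂ h₁₂).vel t = deriv elastica t := derivWithin_elastica h₁₂ ht

theorem isDirectionAngle_elasticaSegment (h₁₂ : t₁ < t₂) :
    (elasticaSegment t₁ t₂ h₁₂).IsDirectionAngle
      fun s => elasticaAngle ((elasticaSegment t₁ t₂ h₁₂).arcParam s) := by
  set f := elasticaSegment t₁ t₂ h₁₂
  obtain ⟨K, hK⟩ := f.exists_lipschitz_arcParam
  refine ⟨?_, fun s hs => ?_⟩
  · refine LipschitzOnWith.absolutelyContinuousOnInterval (K := 2 * K) ?_
    rw [uIcc_of_le f.length_pos.le]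
    exact lipschitzWith_elasticaAngle.comp_lipschitzOnWith hK
  · rw [f.unitSpeed_vel hs, elasticaSegment_vel h₁₂ (f.arcParam_mem hs), deriv_elastica_div_norm]

/-- Passing to arc length divides the derivative of the angle by the speed, which cancels the root:
the curvature is `2x`. -/
theorem signedCurvature_elasticaSegment (h₁₂ : t₁ < t₂) {s : ℝ}
    (hs : s ∈ Ioo 0 (elasticaSegment t₁ t₂ h₁₂).length) :
    (elasticaSegment t₁ t₂ h₁₂).signedCurvature s =
      2 * Real.sin ((elasticaSegment t₁ t₂ h₁₂).arcParam s) := by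
  rw [(isDirectionAngle_elasticaSegment h₁₂).signedCurvature_eq hs]
  set f := elasticaSegment t₁ t₂ h₁₂
  have hp := f.arcParam_mem (Ioo_subset_Icc_self hs)
  have h1 := (hasDerivAt_elasticaAngle (f.arcParam s)).comp s (f.hasDerivAt_arcParam hs)
  rw [elasticaSegment_vel h₁₂ hp, norm_deriv_elastica, inv_inv,
    div_mul_cancel₀ _ (sqrt_one_add_sin_sq_pos _).ne'] at h1
  exact h1.deriv

theorem ae_signedCurvature_elasticaSegment (h₁₂ : t₁ < t₂) :
    ∀ᵐ s ∂volume.restrict (Icc 0 (elasticaSegment t₁ t₂ h₁₂).length),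
      s ∈ Icc 0 (elasticaSegment t₁ t₂ h₁₂).length ∧
      (elasticaSegment t₁ t₂ h₁₂).signedCurvature s =
        2 * Real.sin ((elasticaSegment t₁ t₂ h₁₂).arcParam s) := by
  rw [← restrict_Ioo_eq_restrict_Icc]
  filter_upwards [ae_restrict_mem measurableSet_Ioo] with s hs
  exact ⟨Ioo_subset_Icc_self hs, signedCurvature_elasticaSegment h₁₂ hs⟩

theorem isSCurve_elasticaSegment (h₀ : 0 ≤ t₁) (h₁₂ : t₁ < t₂) (h₂ : t₂ ≤ Real.pi) :
    (elasticaSegment t₁ t₂ h₁₂).IsSCurve := by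
  refine Or.inl (Or.inl ⟨?_, ?_⟩)
  · filter_upwards [ae_signedCurvature_elasticaSegment h₁₂] with s hs
    have hp := (elasticaSegment t₁ t₂ h₁₂).arcParam_mem hs.1
    rw [hs.2]
    exact mul_nonneg two_pos.le
      (Real.sin_nonneg_of_nonneg_of_le_pi (h₀.trans hp.1) (hp.2.trans h₂))
  · rw [(isDirectionAngle_elasticaSegment h₁₂).turningAngle_eq, PlaneCurve.arcParam_zero,
      PlaneCurve.arcParam_length]
    have b₁ := elasticaAngle_mem_Icc ⟨h₀, h₁₂.le.trans h₂⟩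
    have b₂ := elasticaAngle_mem_Icc ⟨h₀.trans h₁₂.le, h₂⟩
    exact abs_le.mpr ⟨by simp only [elasticaSegment]; linarith [b₁.2, b₂.1],
      by simp only [elasticaSegment]; linarith [b₁.1, b₂.2]⟩

theorem connects_elasticaSegment (h₁₂ : t₁ < t₂) :
    (elasticaSegment t₁ t₂ h₁₂).Connects (elasticaTangent t₁) (elasticaTangent t₂) := by
  have e₁ := elasticaSegment_vel h₁₂ (left_mem_Icc.mpr h₁₂.le)
  have e₂ := elasticaSegment_vel h₁₂ (right_mem_Icc.mpr h₁₂.le)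
  refine ⟨UnitTangentVector.ext rfl ?_, UnitTangentVector.ext rfl ?_⟩
  · change (elasticaSegment t₁ t₂ h₁₂).vel t₁ / (‖(elasticaSegment t₁ t₂ h₁₂).vel t₁‖ : ℂ) = _
    rw [e₁]; rfl
  · change (elasticaSegment t₁ t₂ h₁₂).vel t₂ / (‖(elasticaSegment t₁ t₂ h₁₂).vel t₂‖ : ℂ) = _
    rw [e₂]; rfl

theorem elasticaSegment_mem_sCurves (h₀ : 0 ≤ t₁) (h₁₂ : t₁ < t₂) (h₂ : t₂ ≤ Real.pi) :
    elasticaSegment t₁ t₂ h₁₂ ∈ sCurves (elasticaTangent t₁) (elasticaTangent t₂) :=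
  ⟨isSCurve_elasticaSegment h₀ h₁₂ h₂, connects_elasticaSegment h₁₂⟩

theorem elastica_im (t : ℝ) : (elastica t).im = elasticaXi t := by simp [elastica]

theorem elastica_re (t : ℝ) : (elastica t).re = Real.sin t := by
  simp [elastica, -Complex.ofReal_sin]

/-- The bending energy of a segment of the rectangular elastica is its height. -/
theorem bendingEnergy_elasticaSegment (h₁₂ : t₁ < t₂) :
    (elasticaSegment t₁ t₂ h₁₂).bendingEnergy = ENNReal.ofReal (elasticaXi t₂ - elasticaXi t₁) := by
  have hτ := isDirectionAngle_elasticaSegment h₁₂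
  have hae := ae_signedCurvature_elasticaSegment h₁₂
  have him := hτ.im_sub_eq_integral ⟨(elasticaSegment t₁ t₂ h₁₂).length_pos.le, le_rfl⟩
  rw [PlaneCurve.unitSpeed_toFun, PlaneCurve.unitSpeed_toFun, PlaneCurve.arcParam_length,
    PlaneCurve.arcParam_zero] at him
  change (elastica t₂).im - (elastica t₁).im = _ at him
  rw [elastica_im, elastica_im] at him
  rw [him, PlaneCurve.bendingEnergy, one_div_four_mul_lintegral_sq,
    intervalIntegral.integral_of_le (PlaneCurve.length_pos _).le,
    ← integral_Icc_eq_integral_Ioc, ofReal_integral_eq_lintegral_ofReal]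
  · refine lintegral_congr_ae ?_
    filter_upwards [hae] with s hs
    -- Along the elastica `κ²/4 = sin² t` is the sine of the direction angle, that is, the
    -- derivative of the height by arc length.
    rw [hs.2, (cos_sin_elasticaAngle _).2]
    ring_nf
  · exact (Real.continuous_sin.comp_continuousOn hτ.continuousOn).integrableOn_Icc
  · refine Eventually.of_forall fun s => ?_
    simp only [Pi.zero_apply, (cos_sin_elasticaAngle _).2]
    positivity

end Segment

/-! ### Minimality and uniqueness of the elastica segment. -/

theorem theorem6p1 (t₁ t₂ : ℝ) (h₀ : 0 ≤ t₁) (h₁₂ : t₁ < t₂) (h₂ : t₂ ≤ Real.pi)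
    (hlt : t₂ - t₁ < Real.pi) :
    (elasticaSegment t₁ t₂ h₁₂ ∈ sCurves (elasticaTangent t₁) (elasticaTangent t₂) ∧
      ∀ g ∈ sCurves (elasticaTangent t₁) (elasticaTangent t₂),
        (elasticaSegment t₁ t₂ h₁₂).bendingEnergy ≤ g.bendingEnergy) ∧
    ∀ f ∈ sCurves (elasticaTangent t₁) (elasticaTangent t₂),
      (∀ g ∈ sCurves (elasticaTangent t₁) (elasticaTangent t₂),
        f.bendingEnergy ≤ g.bendingEnergy) →
      f.Equivalent (elasticaSegment t₁ t₂ h₁₂) := by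
  have m₁ : t₁ ∈ Icc 0 Real.pi := ⟨h₀, h₁₂.le.trans h₂⟩
  have m₂ : t₂ ∈ Icc 0 Real.pi := ⟨h₀.trans h₁₂.le, h₂⟩
  have hθ := strictMonoOn_elasticaAngle m₁ m₂ h₁₂
  have b₁ := elasticaAngle_mem_Icc m₁
  have b₂ := elasticaAngle_mem_Icc m₂
  have hsub := elasticaAngle_sub_lt_pi h₀ h₁₂ h₂ hlt
  have hu : (elasticaTangent t₁).dir = Complex.exp (elasticaAngle t₁ * Complex.I) :=
    deriv_elastica_div_norm t₁
  have hv : (elasticaTangent t₂).dir = Complex.exp (elasticaAngle t₂ * Complex.I) :=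
    deriv_elastica_div_norm t₂
  have hre : (elasticaTangent t₂).pos.re - (elasticaTangent t₁).pos.re =
      √(Real.sin (elasticaAngle t₂)) - √(Real.sin (elasticaAngle t₁)) := by
    rw [sqrt_sin_elasticaAngle m₁, sqrt_sin_elasticaAngle m₂]
    change (elastica t₂).re - (elastica t₁).re = _
    rw [elastica_re, elastica_re]
  have hΔ : elasticaXi t₂ - elasticaXi t₁ =
      (sqrtSinPrimitive (elasticaAngle t₂) - sqrtSinPrimitive (elasticaAngle t₁)) / 2 := by
    rw [elasticaXi_eq m₁, elasticaXi_eq m₂, sub_div]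
  have him : (elasticaTangent t₂).pos.im - (elasticaTangent t₁).pos.im =
      (sqrtSinPrimitive (elasticaAngle t₂) - sqrtSinPrimitive (elasticaAngle t₁)) / 2 := by
    rw [← hΔ]
    change (elastica t₂).im - (elastica t₁).im = _
    rw [elastica_im, elastica_im]
  have hE := bendingEnergy_elasticaSegment h₁₂
  rw [hΔ] at hE
  have hmem := elasticaSegment_mem_sCurves h₀ h₁₂ h₂
  refine ⟨⟨hmem, fun g hg => ?_⟩, fun f hf hmin => ?_⟩
  · rw [hE]
    exact le_bendingEnergy_of_mem_sCurves b₁.1 hθ b₂.2 hsub hu hv hre him hg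
  -- Comparing a minimiser with the segment itself shows that it attains the lower bound.
  · exact equivalent_of_bendingEnergy_le b₁.1 hθ b₂.2 hsub hu hv hre him hf hmem
      (hE ▸ hmin _ hmem) hE.le
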